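/- All algebras below have the same signature. A subuniverse of an algebra $\mathbf A$ is a (possibly empty) subset closed under all basic operations; it is nontrivial if it is proper and nonempty. $\mathrm{Sg}$ denotes the generated subuniverse. An algebra is idempotent if every basic operation $f$ satisfies $f(x,\dots,x)=x$. Let $B$ be a subuniverse of $\mathbf A$. * For a term $t$ of arity $m$, $B$ absorbs $\mathbf A$ with $t$ if $t(B,\dots,B,A,B,\dots,B)\subseteq B$ for every position of $A$. $B$ is absorbing if this holds for some term $t$ of some arity $m\ge 1$. $B$ is a subuniverse of type $BA(t)$, where $t$ is a binary term, if $B$ absorbs $\mathbf A$ with $t$; $B$ is binary absorbing if this holds for some binary term $t$. * $B$ is central (type $C$) if it is absorbing and $(a,a)\notin \mathrm{Sg}_{\mathbf A^2}\big((\{a\}\times B)\cup(B\times\{a\})\big)$ for every $a\in A\setminus B$. * $B$ is projective if every basic operation $f$ has a coordinate $i$ such that $f(x_1,\dots,x_k)\in B$ whenever $x_i\in B$. * An algebra $\mathbf D$ is polynomially complete if the clone generated by its basic operations and all constants contains all operations on $D$. It is a PC algebra without BACP if it is polynomially complete and has no nontrivial subuniverse that is binary absorbing, central or projective. * $B$ is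 a PC subuniverse (type $PC$) if $B=A$, or $B=\varnothing$, or $B$ is a block of a congruence $\sigma$ on $\mathbf A$ such that $\mathbf A/\sigma\cong \mathbf D_1\times\dots\times\mathbf D_s$, where every $\mathbf D_j$ is a PC algebra without BACP. For $\mathcal T\in\{BA(t),C,PC\}$, write $B\le_{\mathcal T}\mathbf A$ if $B$ is a subuniverse of $\mathbf A$ of type $\mathcal T$. A relation $R\subseteq A_1\times\dots\times A_n$ is subdirect if its projection to every coordinate $i$ is $A_i$. It is $(B_1,\dots,B_n)$-essential if $R\cap(B_1\times\dots\times B_{i-1}\times A_i\times B_{i+1}\times\dots\times B_n)\ne\varnothing$ for every $i$, but $R\cap(B_1\times\dots\times B_n)=\varnothing$. **Theorem.** Let $n\ge 2$, let $\mathbf A_1,\dots,\mathbf A_n$ be finite idempotent algebras, let $\mathbf R$ be a subdirect subalgebra of $\mathbf A_1\times\dots\times\mathbf A_n$, let $\mathcal T$ be one of the types $BA(t)$ (with one fixed binary term $t$), $C$, $PC$, and let $B_i\le_{\mathcal T}\mathbf A_i$ for every $i\in\{1,\dots,n\}$. Then 1. $R\cap(B_1\times\dots\times B_n)\le_{\mathcal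 T}\mathbf R$; 2. if $\mathcal T\ne PC$ or $\mathbf A_1$ has no nontrivial central subuniverse, then $\mathrm{pr}_1\big(R\cap(B_1\times\dots\times B_n)\big)\le_{\mathcal T}\mathbf A_1$; 3. if $R$ is $(B_1,\dots,B_n)$-essential, then $\mathcal T\in\{C,PC\}$ and $n=2$. -/

import Mathlib

/-!
Algebras over a signature are structures over a first-order language `L` without relation symbols
(`L.IsAlgebraic`). Two algebras are of the same type when they are structures over the same `L`.
Subuniverses are Mathlib's substructures (possibly empty), term operations are the realizations
of `L`-terms, and the generated subuniverse is `Substructure.closure`.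
-/

namespace StrongSub

open FirstOrder FirstOrder.Language

universe u v w z

section Basic

/-- The direct product of a family of algebras; all operations act coordinatewise. -/
instance piStructure (L : FirstOrder.Language.{u, v}) {ι : Type z} (A : ι → Type w)
    [∀ i, L.Structure (A i)] : L.Structure (∀ i, A i) where
  funMap f x := fun i => Structure.funMap f (fun k => x k i)
  RelMap r x := ∀ i, Structure.RelMap r (fun k => x k i)

/-- The projection of a product onto its `i`-th coordinate, as a homomorphism. -/
def projHom (L : FirstOrder.Language.{u, v}) {ι : Type z} (A : ι → Type w)
    [∀ i, L.Structure (A i)] (i : ι) : (∀ i, A i) →[L] A i where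
  toFun x := x i
  map_fun' := by intro n f x; rfl
  map_rel' := by intro n r x h; exact h i

/-- The subuniverse `∏ᵢ Bᵢ` of `∏ᵢ Aᵢ`. -/
def prodSub {L : FirstOrder.Language.{u, v}} {ι : Type z} {A : ι → Type w}
    [∀ i, L.Structure (A i)] (B : ∀ i, L.Substructure (A i)) : L.Substructure (∀ i, A i) where
  carrier := {x | ∀ i, x i ∈ B i}
  fun_mem := by
    intro n f x hx i
    exact (B i).fun_mem f (fun k => x k i) (fun k => hx k i)

/-- Every basic operation satisfies `f(x, …, x) = x`. -/
def IsIdempotent (L : FirstOrder.Language.{u, v}) (A : Type w) [L.Structure A] : Prop :=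
  ∀ (k : ℕ) (f : L.Functions k) (a : A), Structure.funMap f (fun _ => a) = a

/-- A congruence: an equivalence relation preserved by all basic operations. -/
structure Congruence (L : FirstOrder.Language.{u, v}) (A : Type w) [L.Structure A] extends Setoid A where
  preserved : ∀ (k : ℕ) (f : L.Functions k) (x y : Fin k → A),
    (∀ i, toSetoid (x i) (y i)) → toSetoid (Structure.funMap f x) (Structure.funMap f y)

/-- The universe `A / σ` of the factor algebra. -/
def Congruence.Factor {L : FirstOrder.Language.{u, v}} {A : Type w} [L.Structure A]
    (σ : Congruence L A) : Type w :=
  Quotient σ.toSetoid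

/-- The factor algebra `A / σ`. -/
instance Congruence.factorStructure {L : FirstOrder.Language.{u, v}} [L.IsAlgebraic] {A : Type w}
    [inst : L.Structure A] (σ : Congruence L A) : L.Structure σ.Factor :=
  @quotientStructure L A σ.toSetoid
    { toStructure := inst
      fun_equiv := fun {_ f} x y h => σ.preserved _ f x y h
      rel_equiv := fun {_ r} _ _ _ => isEmptyElim r }

/-- The operations of `A / σ` are computed on representatives. -/
theorem Congruence.funMap_factor {L : FirstOrder.Language.{u, v}} [L.IsAlgebraic] {A : Type w}
    [inst : L.Structure A] (σ : Congruence L A) {k : ℕ} (f : L.Functions k) (x : Fin k → A) :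
    Structure.funMap (M := σ.Factor) f (fun i => Quotient.mk σ.toSetoid (x i)) =
      Quotient.mk σ.toSetoid (Structure.funMap f x) :=
  @funMap_quotient_mk' L A σ.toSetoid
    { toStructure := inst
      fun_equiv := fun {_ f} x y h => σ.preserved _ f x y h
      rel_equiv := fun {_ r} _ _ _ => isEmptyElim r } k f x

/-- A subuniverse is nontrivial if it is proper and nonempty. -/
def IsNontrivial {L : FirstOrder.Language.{u, v}} {A : Type w} [L.Structure A]
    (B : L.Substructure A) : Prop :=
  B ≠ ⊤ ∧ (B : Set A).Nonempty

end Basic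

section Types

variable {L : FirstOrder.Language.{u, v}} {A : Type w} [L.Structure A]

/-- `B` absorbs `A` with the `m`-ary term operation `t`:
`t(B, …, B, A, B, …, B) ⊆ B` for every position of `A`. -/
def AbsorbsWith (B : L.Substructure A) {m : ℕ} (t : L.Term (Fin m)) : Prop :=
  ∀ (i : Fin m) (x : Fin m → A), (∀ j, j ≠ i → x j ∈ B) → t.realize x ∈ B

/-- Absorbing subuniverse. -/
def IsAbsorbing (B : L.Substructure A) : Prop :=
  ∃ m : ℕ, 0 < m ∧ ∃ t : L.Term (Fin m), AbsorbsWith B t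

/-- Binary absorbing subuniverse. -/
def IsBinaryAbsorbing (B : L.Substructure A) : Prop :=
  ∃ t : L.Term (Fin 2), AbsorbsWith B t

/-- Central subuniverse: `C` is absorbing and, for every `a ∈ A \ C`, the pair `(a, a)` is not in
the subuniverse of `A²` generated by `({a} × C) ∪ (C × {a})`. -/
def IsCentral (C : L.Substructure A) : Prop :=
  IsAbsorbing C ∧ ∀ a : A, a ∉ C →
    (![a, a] : Fin 2 → A) ∉ Substructure.closure L
      ({p : Fin 2 → A | p 0 = a ∧ p 1 ∈ C} ∪ {p : Fin 2 → A | p 0 ∈ C ∧ p 1 = a})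

/-- Projective subuniverse: every basic operation `f` has a coordinate `i` such that
`f(x₁, …, xₖ) ∈ B` whenever `xᵢ ∈ B`. -/
def IsProjective (B : L.Substructure A) : Prop :=
  ∀ (k : ℕ) (f : L.Functions k), ∃ i : Fin k, ∀ x : Fin k → A, x i ∈ B → Structure.funMap f x ∈ B

/-- Polynomially complete algebra: every operation on `D` is given by a term in the basic
operations and the constants from `D` (the variables `Sum.inl d` stand for the constants `d`). -/
def IsPolynomiallyComplete (L : FirstOrder.Language.{u, v}) (D : Type w) [L.Structure D] : Prop :=
  ∀ (k : ℕ) (g : (Fin k → D) → D), ∃ t : L.Term (D ⊕ Fin k),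
    ∀ x : Fin k → D, t.realize (Sum.elim id x) = g x

/-- A polynomially complete algebra without nontrivial binary absorbing, central, or projective
subuniverses. -/
def IsPCWithoutBACP (L : FirstOrder.Language.{u, v}) (D : Type w) [L.Structure D] : Prop :=
  IsPolynomiallyComplete L D ∧ ∀ S : L.Substructure D, IsNontrivial S →
    ¬ IsBinaryAbsorbing S ∧ ¬ IsCentral S ∧ ¬ IsProjective S

/-- PC subuniverse: all of `A`, or empty, or a block of a congruence `σ` such that `A / σ` is
isomorphic to a finite product of PC algebras without BACP. -/
def IsPC [L.IsAlgebraic] (B : L.Substructure A) : Prop :=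
  B = ⊤ ∨ (B : Set A) = ∅ ∨
    ∃ σ : Congruence L A, (∃ a : A, (B : Set A) = {x | σ.toSetoid x a}) ∧
      ∃ (s : ℕ) (D : Fin s → Type w) (_ : ∀ j, L.Structure (D j)),
        (∀ j, IsPCWithoutBACP L (D j)) ∧ Nonempty (σ.Factor ≃[L] (∀ j, D j))

/-- The types of strong subuniverses: `BA(t)` for a binary term `t`, `C`, and `PC`. -/
inductive StrongType (L : FirstOrder.Language.{u, v}) : Type u
  | BA (t : L.Term (Fin 2))
  | C
  | PC

/-- `B` is a (strong) subuniverse of `A` of type `T`. -/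
def IsOfType [L.IsAlgebraic] (T : StrongType L) (B : L.Substructure A) : Prop :=
  match T with
  | .BA t => AbsorbsWith B t
  | .C => IsCentral B
  | .PC => IsPC B

end Types

/-- `R ⊆ ∏ᵢ Aᵢ` is subdirect: every projection of `R` to a coordinate is onto. -/
def IsSubdirect {ι : Type z} {A : ι → Type w} (R : Set (∀ i, A i)) : Prop :=
  ∀ (i : ι) (a : A i), ∃ r ∈ R, r i = a

/-- `R` is `(C₁, …, Cₙ)`-essential: for every `i` it meets
`C₁ × ⋯ × Cᵢ₋₁ × Aᵢ × Cᵢ₊₁ × ⋯ × Cₙ`, but it does not meet `C₁ × ⋯ × Cₙ`. -/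
def IsEssential {ι : Type z} {A : ι → Type w} (R : Set (∀ i, A i)) (C : ∀ i, Set (A i)) : Prop :=
  (∀ i, ∃ r ∈ R, ∀ j, j ≠ i → r j ∈ C j) ∧ ¬ ∃ r ∈ R, ∀ j, r j ∈ C j

end StrongSub

/-! Pulling each `B i` back to `R` along the (surjective) coordinate map reduces everything to
subuniverses of a single algebra. Each type must survive these preimages, finite intersections and
surjective images, and an essential relation becomes a critical family, whose size has to be bounded
by 2.

A critical family with a common absorbing term has fewer members than that term has variables. This
excludes type BA(t) at once. For central subuniverses, a critical family of m ≥ 3 members produces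
one of 2(m - 1) members on another algebra, with the same absorbing term
(`IsCritical.exists_larger`); iteration outgrows the arity. Centrality of images (`IsCentral.map`)
comes from a minimal subuniverse argument around a periodic point of a unary polynomial.

The PC type is tied to centrality by `isCentral_fullSub`: the points over which given homomorphisms
to PC algebras without BACP are jointly onto form a central subuniverse. Hence, over an algebra
without nontrivial central subuniverses, one full fibre makes all fibres full. Polynomial
completeness supplies a full fibre as soon as a homomorphism fails to factor, and rules out the
abelian-like obstruction to passing from pairwise to joint surjectivity
(`jointly_surjective_triple`). A nonempty PC subuniverse is thus the solution set of independent
equations, one for each kernel, and the PC claims follow by comparing kernels. -/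

namespace StrongSub

open FirstOrder FirstOrder.Language

universe u v w z

/-! ### Terms in products and star composition -/

section Terms

variable {L : FirstOrder.Language.{u, v}}

theorem realize_pi {ι : Type z} {A : ι → Type w} [∀ i, L.Structure (A i)] {α : Type*}
    (t : L.Term α) (x : α → ∀ i, A i) (i : ι) :
    t.realize x i = t.realize (fun k => x k i) :=
  (HomClass.realize_term (projHom L A i) (t := t) (v := x)).symm

theorem IsIdempotent.realize_const {A : Type w} [L.Structure A] (hA : IsIdempotent L A)
    {α : Type*} (t : L.Term α) (a : A) : t.realize (fun _ => a) = a := by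
  induction t with
  | var _ => rfl
  | func f ts ih =>
    rw [Term.realize_func]
    simp only [ih]
    exact hA _ f a

theorem IsIdempotent.pi {ι : Type z} {A : ι → Type w} [∀ i, L.Structure (A i)]
    (h : ∀ i, IsIdempotent L (A i)) : IsIdempotent L (∀ i, A i) := by
  intro k f a
  funext i
  exact h i k f (a i)

theorem IsIdempotent.substructure {A : Type w} [L.Structure A] (h : IsIdempotent L A)
    (S : L.Substructure A) : IsIdempotent L S := by
  intro k f a
  exact Subtype.ext (h k f a)

theorem IsIdempotent.of_surjective {A B : Type*} [L.Structure A] [L.Structure B]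
    (h : IsIdempotent L A) (φ : A →[L] B) (hφ : Function.Surjective φ) : IsIdempotent L B := by
  intro k f b
  obtain ⟨a, rfl⟩ := hφ b
  have := φ.map_fun f (fun _ => a)
  rw [h k f a] at this
  exact this.symm

theorem realize_pair_mem {A : Type w} [L.Structure A] (S : L.Substructure (Fin 2 → A))
    {α : Type*} (t : L.Term α) (x y : α → A) (h : ∀ i, ![x i, y i] ∈ S) :
    ![t.realize x, t.realize y] ∈ S := by
  have := t.realize_mem (S := S) (fun i => ![x i, y i]) h
  convert this using 1
  funext i
  rw [realize_pi]
  fin_cases i <;> rfl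

/-- The fibre of a homomorphism into an idempotent algebra. -/
def fiber {Q A : Type*} [L.Structure Q] [L.Structure A] (hA : IsIdempotent L A)
    (φ : Q →[L] A) (a : A) : L.Substructure Q where
  carrier := {q | φ q = a}
  fun_mem := by
    intro n f x hx
    have : φ (Structure.funMap f x) = a := by
      rw [φ.map_fun]
      have : (φ ∘ x) = fun _ => a := funext hx
      rw [this, hA]
    exact this

/-- The set of right neighbours of `a` in a compatible binary relation. -/
def section₂ {A : Type*} [L.Structure A] (hA : IsIdempotent L A)
    (S : L.Substructure (Fin 2 → A)) (a : A) : L.Substructure A where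
  carrier := {q | ![a, q] ∈ S}
  fun_mem := by
    intro n f x hx
    have := realize_pair_mem S (Term.func f Term.var) (fun _ => a) x hx
    rw [hA.realize_const] at this
    exact this

/-- The star composition `t(s(…), …, s(…))` of two terms in disjoint variables. -/
def star {α β : Type} (t : L.Term α) (s : L.Term β) : L.Term (α × β) :=
  t.subst fun i => s.relabel fun j => (i, j)

theorem realize_star {A : Type w} [L.Structure A] {α β : Type} (t : L.Term α) (s : L.Term β)
    (x : α × β → A) :
    (star t s).realize x = t.realize fun i => s.realize fun j => x (i, j) := by
  simp only [star, Term.realize_subst, Term.realize_relabel]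
  rfl

/-- Finitely many properties of terms that are stable under star composition from both sides and
are satisfiable separately are satisfiable by a common term. -/
theorem exists_common_term {κ : Type*} [Finite κ] (P : κ → ∀ α : Type, L.Term α → Prop)
    (hl : ∀ k (α β : Type) (t : L.Term α) (s : L.Term β), P k α t → P k (α × β) (star t s))
    (hr : ∀ k (α β : Type) (t : L.Term α) (s : L.Term β), P k β s → P k (α × β) (star t s))
    (h : ∀ k, ∃ (α : Type) (_ : Finite α) (_ : Nonempty α) (t : L.Term α), P k α t) :
    ∃ (α : Type) (_ : Finite α) (_ : Nonempty α) (t : L.Term α), ∀ k, P k α t := by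
  classical
  have := Fintype.ofFinite κ
  suffices H : ∀ s : Finset κ, ∃ (α : Type) (_ : Finite α) (_ : Nonempty α) (t : L.Term α),
      ∀ k ∈ s, P k α t by
    obtain ⟨α, h1, h2, t, ht⟩ := H Finset.univ
    exact ⟨α, h1, h2, t, fun k => ht k (Finset.mem_univ k)⟩
  intro s
  induction s using Finset.induction_on with
  | empty => exact ⟨Unit, inferInstance, inferInstance, Term.var (), by simp⟩
  | insert k s _ ih =>
    obtain ⟨α, h1, h2, t, ht⟩ := ih
    obtain ⟨β, h3, h4, s', hs'⟩ := h k
    refine ⟨α × β, inferInstance, inferInstance, star t s', fun k' hk' => ?_⟩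
    rcases Finset.mem_insert.1 hk' with rfl | hk'
    · exact hr _ _ _ _ _ hs'
    · exact hl _ _ _ _ _ (ht _ hk')

end Terms

/-! ### Absorption and its stability -/

section Absorption

variable {L : FirstOrder.Language.{u, v}}

/-- Absorption with a term in an arbitrary set of variables. -/
def Absorbs {A : Type w} [L.Structure A] (B : L.Substructure A) {α : Type} (t : L.Term α) : Prop :=
  ∀ (i : α) (x : α → A), (∀ j, j ≠ i → x j ∈ B) → t.realize x ∈ B

variable {A : Type w} [L.Structure A]

theorem Absorbs.star_left {B : L.Substructure A} {α β : Type} {t : L.Term α} (s : L.Term β)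
    (h : Absorbs B t) : Absorbs B (star t s) := by
  rintro ⟨i, j⟩ x hx
  rw [realize_star]
  refine h i _ fun i' hi' => Term.realize_mem _ _ fun j' => hx _ ?_
  simp [hi']

theorem Absorbs.star_right {B : L.Substructure A} {α β : Type} (t : L.Term α) {s : L.Term β}
    (h : Absorbs B s) : Absorbs B (star t s) := by
  rintro ⟨i, j⟩ x hx
  rw [realize_star]
  refine Term.realize_mem _ _ fun i' => h j _ fun j' hj' => hx _ ?_
  simp [hj']

/-- Arbitrary finite variable sets let star compositions, whose variables form a product, be used
without renumbering. -/
theorem isAbsorbing_iff {B : L.Substructure A} :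
    IsAbsorbing B ↔ ∃ (α : Type) (_ : Finite α) (_ : Nonempty α) (t : L.Term α), Absorbs B t := by
  constructor
  · rintro ⟨m, hm, t, ht⟩
    exact ⟨Fin m, inferInstance, ⟨⟨0, hm⟩⟩, t, ht⟩
  · rintro ⟨α, _, _, t, ht⟩
    have e := Finite.equivFin α
    refine ⟨Nat.card α, Nat.card_pos, t.relabel e, fun i x hx => ?_⟩
    rw [Term.realize_relabel]
    exact ht (e.symm i) _ fun j hj => hx _ fun h => hj (by rw [← h, e.symm_apply_apply])

theorem Absorbs.comap {Q : Type*} [L.Structure Q] (φ : Q →[L] A) {B : L.Substructure A} {α : Type}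
    {t : L.Term α} (h : Absorbs B t) : Absorbs (B.comap φ) t := by
  intro i x hx
  rw [Substructure.mem_comap, ← HomClass.realize_term]
  exact h i _ hx

theorem Absorbs.iInf {ι : Sort*} {B : ι → L.Substructure A} {α : Type}
    {t : L.Term α} (h : ∀ i, Absorbs (B i) t) : Absorbs (⨅ i, B i) t := by
  intro i x hx
  rw [Substructure.mem_iInf]
  exact fun k => h k i x fun j hj => Substructure.mem_iInf.1 (hx j hj) k

theorem Absorbs.map {Q : Type*} [L.Structure Q] {φ : Q →[L] A} (hφ : Function.Surjective φ)
    {B : L.Substructure Q} {α : Type} {t : L.Term α} (h : Absorbs B t) : Absorbs (B.map φ) t := by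
  classical
  intro i x hx
  choose y hy using hφ
  choose z hz using fun j : {j // j ≠ i} => Substructure.mem_map.1 (hx j j.2)
  refine Substructure.mem_map.2 ⟨t.realize fun j => if hj : j ≠ i then z ⟨j, hj⟩ else y (x j),
    h i _ fun j hj => ?_, ?_⟩
  · simpa [hj] using (hz ⟨j, hj⟩).1
  · rw [← HomClass.realize_term]
    congr 1
    funext j
    by_cases hj : j = i
    · simp [hj, hy]
    · simpa [hj] using (hz ⟨j, hj⟩).2

theorem exists_common_absorbs {κ : Type*} [Finite κ] {A : κ → Type w} [∀ k, L.Structure (A k)]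
    (B : ∀ k, L.Substructure (A k)) (h : ∀ k, IsAbsorbing (B k)) :
    ∃ (α : Type) (_ : Finite α) (_ : Nonempty α) (t : L.Term α), ∀ k, Absorbs (B k) t :=
  exists_common_term (fun k _ t => Absorbs (B k) t) (fun _ _ _ _ s ht => ht.star_left s)
    (fun _ _ _ t _ hs => hs.star_right t) fun k => isAbsorbing_iff.1 (h k)

end Absorption

/-! ### Central subuniverses: preimages, intersections, images -/

section Central

variable {L : FirstOrder.Language.{u, v}} {A : Type w} [L.Structure A]

/-- The subuniverse of `A²` generated by `({a} × C) ∪ (C × {a})`. -/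
def crossSg (L : FirstOrder.Language.{u, v}) {A : Type w} [L.Structure A] (C : Set A) (a : A) :
    L.Substructure (Fin 2 → A) :=
  Substructure.closure L
    ({p : Fin 2 → A | p 0 = a ∧ p 1 ∈ C} ∪ {p : Fin 2 → A | p 0 ∈ C ∧ p 1 = a})

theorem mk_left_mem_crossSg {C : Set A} {a c : A} (hc : c ∈ C) : ![a, c] ∈ crossSg L C a :=
  Substructure.subset_closure (Or.inl ⟨rfl, hc⟩)

theorem mk_right_mem_crossSg {C : Set A} {a c : A} (hc : c ∈ C) : ![c, a] ∈ crossSg L C a :=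
  Substructure.subset_closure (Or.inr ⟨hc, rfl⟩)

theorem crossSg_le {C : Set A} {a : A} {S : L.Substructure (Fin 2 → A)}
    (h1 : ∀ c ∈ C, ![a, c] ∈ S) (h2 : ∀ c ∈ C, ![c, a] ∈ S) : crossSg L C a ≤ S := by
  refine Substructure.closure_le.2 ?_
  rintro p (⟨h, hp⟩ | ⟨hp, h⟩)
  · have : p = ![a, p 1] := by funext i; fin_cases i <;> simp [h]
    rw [this]; exact h1 _ hp
  · have : p = ![p 0, a] := by funext i; fin_cases i <;> simp [h]
    rw [this]; exact h2 _ hp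

theorem crossSg_mono {C C' : Set A} (h : C ⊆ C') (a : A) : crossSg L C a ≤ crossSg L C' a :=
  crossSg_le (fun _ hc => mk_left_mem_crossSg (h hc)) fun _ hc => mk_right_mem_crossSg (h hc)

theorem isCentral_iff {C : L.Substructure A} :
    IsCentral C ↔ IsAbsorbing C ∧ ∀ a, a ∉ C → ![a, a] ∉ crossSg L (C : Set A) a := Iff.rfl

/-- A description of the diagonal pairs in `crossSg L C a` by one term. -/
theorem exists_term_of_mem_crossSg {C : L.Substructure A} {a : A} (ha : a ∉ C)
    (h : ![a, a] ∈ crossSg L (C : Set A) a) :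
    ∃ (γ : Type w) (t : L.Term γ) (r : γ → Prop) (c : γ → A), (∀ p, c p ∈ C) ∧
      (∀ x y : γ → A, (∀ p, r p → x p = a ∧ y p = c p) → (∀ p, ¬ r p → x p = c p ∧ y p = a) →
        t.realize x = a ∧ t.realize y = a) := by
  classical
  obtain ⟨t, ht⟩ := Substructure.mem_closure_iff_exists_term.1 h
  -- As `a ∉ C`, a generator lies in `{a} × C` exactly when its first entry is `a`; `c` picks its
  -- other entry.
  refine ⟨_, t, fun p => p.1 0 = a, fun p => if p.1 0 = a then p.1 1 else p.1 0, ?_, ?_⟩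
  · rintro ⟨p, ⟨h0, h1⟩ | ⟨h0, h1⟩⟩
    · simpa [h0] using h1
    · have : p 0 ≠ a := fun h => ha (h ▸ h0)
      simpa [this] using h0
  · intro x y hx hy
    have hxp : ∀ p, x p = p.1 0 := by
      intro p
      by_cases hp : p.1 0 = a
      · rw [(hx p hp).1, hp]
      · exact (hy p hp).1.trans (if_neg hp)
    have hyp : ∀ p, y p = p.1 1 := by
      intro p
      by_cases hp : p.1 0 = a
      · exact (hx p hp).2.trans (if_pos hp)
      · rw [(hy p hp).2]
        obtain ⟨p, ⟨h0, h1⟩ | ⟨h0, h1⟩⟩ := p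
        · exact absurd h0 hp
        · exact h1.symm
    constructor
    · have := congrFun ht 0
      rw [realize_pi] at this
      rw [funext hxp]
      exact this
    · have := congrFun ht 1
      rw [realize_pi] at this
      rw [funext hyp]
      exact this

theorem IsCentral.comap {Q : Type*} [L.Structure Q] (φ : Q →[L] A) {C : L.Substructure A}
    (h : IsCentral C) : IsCentral (C.comap φ) := by
  refine isCentral_iff.2 ⟨?_, fun a ha hmem => ?_⟩
  · obtain ⟨α, h1, h2, t, ht⟩ := isAbsorbing_iff.1 h.1
    exact isAbsorbing_iff.2 ⟨α, h1, h2, t, ht.comap φ⟩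
  · obtain ⟨γ, t, r, c, hc, H⟩ := exists_term_of_mem_crossSg ha hmem
    classical
    obtain ⟨e1, e2⟩ := H (fun p => if r p then a else c p) (fun p => if r p then c p else a)
      (fun p hp => by simp [hp]) (fun p hp => by simp [hp])
    refine h.2 (φ a) ha ?_
    have hφc : ∀ p, φ (c p) ∈ (C : Set A) := hc
    have := realize_pair_mem (crossSg L (C : Set A) (φ a)) t
      (φ ∘ fun p => if r p then a else c p) (φ ∘ fun p => if r p then c p else a) fun p => by
        by_cases hp : r p
        · simpa [hp] using mk_left_mem_crossSg (hφc p)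
        · simpa [hp] using mk_right_mem_crossSg (hφc p)
    rw [HomClass.realize_term, HomClass.realize_term, e1, e2] at this
    exact this

theorem IsCentral.iInf {ι : Type*} [Finite ι] {C : ι → L.Substructure A}
    (h : ∀ i, IsCentral (C i)) : IsCentral (⨅ i, C i) := by
  refine isCentral_iff.2 ⟨?_, fun a ha hmem => ?_⟩
  · obtain ⟨α, h1, h2, t, ht⟩ := exists_common_absorbs C fun i => (h i).1
    exact isAbsorbing_iff.2 ⟨α, h1, h2, t, Absorbs.iInf ht⟩
  · rw [Substructure.mem_iInf, not_forall] at ha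
    obtain ⟨i, hi⟩ := ha
    exact (isCentral_iff.1 (h i)).2 a hi (crossSg_mono (iInf_le C i) a hmem)

/-- A surjective homomorphism maps central subuniverses to central subuniverses. -/
theorem IsCentral.map {Q : Type*} [L.Structure Q] [Finite Q] (hQ : IsIdempotent L Q)
    {φ : Q →[L] A} (hφ : Function.Surjective φ) {C : L.Substructure Q}
    (h : IsCentral C) : IsCentral (C.map φ) := by
  classical
  refine isCentral_iff.2 ⟨?_, fun a ha hmem => ?_⟩
  · obtain ⟨α, h1, h2, t, ht⟩ := isAbsorbing_iff.1 h.1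
    exact isAbsorbing_iff.2 ⟨α, h1, h2, t, ht.map hφ⟩
  obtain ⟨γ, t, r, c, hc, H⟩ := exists_term_of_mem_crossSg ha hmem
  choose c' hc' hφc using fun p => Substructure.mem_map.1 (hc p)
  -- The two rows of the term identity for `(a, a)`, lifted to `Q` with the entries `a` replaced by
  -- a variable. Both maps preserve the fibre over `a`.
  set f : Q → Q := fun x => t.realize fun p => if r p then x else c' p with hf
  set g : Q → Q := fun x => t.realize fun p => if r p then c' p else x with hg
  have hfg : ∀ x, φ x = a → φ (f x) = a ∧ φ (g x) = a := by
    intro x hx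
    have := H (φ ∘ fun p => if r p then x else c' p) (φ ∘ fun p => if r p then c' p else x)
      (fun p hp => by simp [hp, hx, hφc]) (fun p hp => by simp [hp, hx, hφc])
    rwa [HomClass.realize_term, HomClass.realize_term] at this
  have hA : IsIdempotent L A := hQ.of_surjective φ hφ
  let good : L.Substructure Q → Prop := fun D =>
    (∃ x, x ∈ D) ∧ (∀ x ∈ D, x ∉ C) ∧ ∀ x ∈ D, f x ∈ D ∧ g x ∈ D
  have hgood : good (fiber hA φ a) := by
    refine ⟨hφ a, fun x hx hxC => ha ?_, fun x hx => hfg x hx⟩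
    exact Substructure.mem_map.2 ⟨x, hxC, hx⟩
  have : Finite (L.Substructure Q) := Finite.of_injective _ SetLike.coe_injective
  obtain ⟨D, hD⟩ := (Set.toFinite {D | good D}).exists_minimal ⟨_, hgood⟩
  obtain ⟨⟨x₀, hx₀⟩, hDC, hDfg⟩ := hD.prop
  have hiter : ∀ k x, x ∈ D → f^[k] x ∈ D := by
    intro k
    induction k with
    | zero => exact fun x hx => hx
    | succ k ih => exact fun x hx => ih _ (hDfg x hx).1
  -- Finiteness gives an `f`-periodic point `x` in `D`, so that iterating `f` on the first entry of
  -- a pair returns to `x`.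
  obtain ⟨i, j, hij, hper⟩ := Finite.exists_ne_map_eq_of_infinite fun k : ℕ => f^[k] x₀
  obtain ⟨x, hx, N, hN⟩ : ∃ x ∈ D, ∃ N, f^[N + 1] x = x := by
    rcases lt_or_gt_of_ne hij with hlt | hlt
    · refine ⟨f^[i] x₀, hiter _ _ hx₀, j - i - 1, ?_⟩
      rw [← Function.iterate_add_apply, show j - i - 1 + 1 + i = j by omega]
      exact hper.symm
    · refine ⟨f^[j] x₀, hiter _ _ hx₀, i - j - 1, ?_⟩
      rw [← Function.iterate_add_apply, show i - j - 1 + 1 + j = i by omega]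
      exact hper
  set S := crossSg L (C : Set Q) x with hS
  have hpair : ∀ k, ∃ q ∈ D, ![f^[k + 1] x, q] ∈ S := by
    intro k
    induction k with
    | zero =>
      refine ⟨g x, (hDfg x hx).2, realize_pair_mem S t _ _ fun p => ?_⟩
      by_cases hp : r p
      · simpa [hp] using mk_left_mem_crossSg (hc' p)
      · simpa [hp] using mk_right_mem_crossSg (hc' p)
    | succ k ih =>
      obtain ⟨q, hq, hqS⟩ := ih
      -- Apply `t` to the pair already found at the positions in `r` and to `(c' p, x)` elsewhere:
      -- the first entry advances by `f`, the second stays in `D`.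
      refine ⟨t.realize fun p => if r p then q else x, Term.realize_mem _ _ fun p => ?_, ?_⟩
      · split_ifs <;> assumption
      · rw [Function.iterate_succ_apply']
        refine realize_pair_mem S t _ _ fun p => ?_
        by_cases hp : r p
        · simpa [hp] using hqS
        · simpa [hp] using mk_right_mem_crossSg (hc' p)
  obtain ⟨q, hq, hqS⟩ := hpair N
  rw [hN] at hqS
  have hsec : ∀ y, y ∈ section₂ hQ S x → f y ∈ section₂ hQ S x ∧ g y ∈ section₂ hQ S x := by
    intro y hy
    have hCs : ∀ c ∈ C, c ∈ section₂ hQ S x := fun c hc => mk_left_mem_crossSg hc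
    constructor
    · refine Term.realize_mem _ _ fun p => ?_
      split_ifs
      exacts [hy, hCs _ (hc' p)]
    · refine Term.realize_mem _ _ fun p => ?_
      split_ifs
      exacts [hCs _ (hc' p), hy]
  -- The neighbours of `x` in `D` again form a good subuniverse, so by minimality `x` is its own
  -- neighbour, against centrality of `C`.
  have hle := hD.le_of_le (y := D ⊓ section₂ hQ S x)
    ⟨⟨q, hq, hqS⟩, fun y hy => hDC y hy.1, fun y hy =>
      ⟨⟨(hDfg y hy.1).1, (hsec y hy.2).1⟩, ⟨(hDfg y hy.1).2, (hsec y hy.2).2⟩⟩⟩ inf_le_left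
  exact (isCentral_iff.1 h).2 x (hDC x hx) (hle hx).2

end Central

/-! ### Critical families and the bound for central subuniverses -/

section Critical

variable {L : FirstOrder.Language.{u, v}}

/-- A family of subuniverses with empty intersection that becomes consistent after removing any
member. -/
def IsCritical {Q : Type w} [L.Structure Q] {ι : Type*} (C : ι → L.Substructure Q) : Prop :=
  (∀ i, ∃ q, ∀ j, j ≠ i → q ∈ C j) ∧ ¬ ∃ q, ∀ j, q ∈ C j

variable {Q : Type w} [L.Structure Q]

/-- Assign distinct members to the variables of `t` and substitute for each variable a point that
may miss only its member. Every member then misses at most one argument, so the value of `t` lies in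
all of them. -/
theorem not_isCritical_of_absorbs {ι α : Type} [Finite ι] [Finite α] [Nonempty α]
    (hcard : Nat.card α ≤ Nat.card ι) {C : ι → L.Substructure Q} {t : L.Term α}
    (ht : ∀ i, Absorbs (C i) t) : ¬ IsCritical C := by
  rintro ⟨h1, h2⟩
  have := Fintype.ofFinite ι
  have := Fintype.ofFinite α
  rw [Nat.card_eq_fintype_card, Nat.card_eq_fintype_card] at hcard
  obtain ⟨e⟩ := Function.Embedding.nonempty_of_card_le hcard
  choose q hq using h1
  refine h2 ⟨t.realize fun i => q (e i), fun j => ?_⟩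
  by_cases hj : ∃ i, e i = j
  · obtain ⟨i, rfl⟩ := hj
    exact ht _ i _ fun i' hi' => hq _ _ fun h => hi' (e.injective h).symm
  · exact ht _ (Classical.arbitrary α) _ fun i' _ => hq _ _ fun h => hj ⟨i', h.symm⟩

/-- From a critical family of at least three central subuniverses one gets a larger critical
family of central subuniverses absorbed by the same term. -/
theorem IsCritical.exists_larger [Finite Q] (hQ : IsIdempotent L Q) {ι α : Type} [Finite ι]
    (hι : 3 ≤ Nat.card ι) {C : ι → L.Substructure Q} (hC : ∀ i, IsCentral (C i)) {t : L.Term α}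
    (ht : ∀ i, Absorbs (C i) t) (h : IsCritical C) :
    ∃ (Q' : Type w) (_ : L.Structure Q') (_ : Finite Q') (ι' : Type) (_ : Finite ι')
      (C' : ι' → L.Substructure Q'), IsIdempotent L Q' ∧ Nat.card ι < Nat.card ι' ∧
        (∀ i, IsCentral (C' i)) ∧ (∀ i, Absorbs (C' i) t) ∧ IsCritical C' := by
  classical
  have : Finite (L.Substructure Q) := Finite.of_injective _ SetLike.coe_injective
  -- A minimal `X` that still witnesses criticality: any smaller subuniverse with such witnesses
  -- must contain `a`.
  let good : L.Substructure Q → Prop := fun X => ∀ i, ∃ q ∈ X, ∀ j, j ≠ i → q ∈ C j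
  have hgood : good ⊤ := fun i => by
    obtain ⟨q, hq⟩ := h.1 i
    exact ⟨q, trivial, hq⟩
  obtain ⟨X, hX⟩ := (Set.toFinite {X | good X}).exists_minimal ⟨_, hgood⟩
  have hXgood : good X := hX.prop
  have hmin : ∀ Y : L.Substructure Q, Y ≤ X → good Y → X ≤ Y := fun Y hY hg => hX.le_of_le hg hY
  obtain ⟨i₀⟩ : Nonempty ι := by
    by_contra hne
    rw [not_nonempty_iff] at hne
    simp at hι
  obtain ⟨a, haX, haC⟩ := hXgood i₀
  have ha : a ∉ C i₀ := fun hmem => h.2 ⟨a, fun j => by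
    by_cases hj : j = i₀
    · exact hj ▸ hmem
    · exact haC j hj⟩
  set S : L.Substructure (Fin 2 → Q) := crossSg L ((C i₀ ⊓ X : L.Substructure Q) : Set Q) a with hS
  have haa : ![a, a] ∉ S := fun hmem =>
    (isCentral_iff.1 (hC i₀)).2 a ha (crossSg_mono (fun _ hx => hx.1) a hmem)
  have hSX : ∀ p ∈ S, ∀ b, p b ∈ X := by
    have hle : S ≤ prodSub (fun _ : Fin 2 => X) := by
      refine crossSg_le (fun c hc b => ?_) fun c hc b => ?_
      · fin_cases b
        exacts [haX, hc.2]
      · fin_cases b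
        exacts [hc.2, haX]
    exact fun p hp => hle hp
  -- no right neighbour of `a` lies in all `C i` with `i ≠ i₀`
  have hnbr : ∀ q ∈ X, (∀ j, j ≠ i₀ → q ∈ C j) → ![a, q] ∉ S := by
    intro q hqX hqC hq
    have hle := hmin (X ⊓ section₂ hQ S a) inf_le_left fun i => by
      by_cases hi : i = i₀
      · subst hi
        exact ⟨q, ⟨hqX, hq⟩, hqC⟩
      · obtain ⟨r, hrX, hr⟩ := hXgood i
        exact ⟨r, ⟨hrX, mk_left_mem_crossSg ⟨hr i₀ (Ne.symm hi), hrX⟩⟩, hr⟩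
    exact haa (hle haX).2
  have hempty : ∀ x y, ![x, y] ∈ S → (∀ j, j ≠ i₀ → x ∈ C j) → (∀ j, j ≠ i₀ → y ∈ C j) → False := by
    intro x y hxy hx hy
    -- The points with a right neighbour in all `C j`, `j ≠ i₀`. If such a pair `(x, y)` exists, `X
    -- ⊓ Y` is good: `x` serves for `i₀`, and for the other indices `a` is the required neighbour.
    let Y : L.Substructure Q :=
      (S ⊓ prodSub ![⊤, ⨅ j : {j // j ≠ i₀}, C j]).map (projHom L (fun _ : Fin 2 => Q) 0)
    have hYiff : ∀ q, q ∈ Y ↔ ∃ r, ![q, r] ∈ S ∧ ∀ j, j ≠ i₀ → r ∈ C j := by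
      intro q
      constructor
      · intro hq
        obtain ⟨p, ⟨hp1, hp2⟩, rfl⟩ := Substructure.mem_map.1 hq
        refine ⟨p 1, ?_, fun j hj => ?_⟩
        · have : ![projHom L (fun _ : Fin 2 => Q) 0 p, p 1] = p := by
            funext i; fin_cases i <;> rfl
          rw [this]
          exact hp1
        · exact Substructure.mem_iInf.1 (show p 1 ∈ ⨅ j : {j // j ≠ i₀}, C j from hp2 1) ⟨j, hj⟩
      · rintro ⟨r, hr, hrC⟩
        refine Substructure.mem_map.2 ⟨![q, r], ⟨hr, fun b => ?_⟩, rfl⟩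
        fin_cases b
        · exact trivial
        · exact Substructure.mem_iInf.2 fun j => hrC j j.2
    have hle := hmin (X ⊓ Y) inf_le_left fun i => by
      by_cases hi : i = i₀
      · subst hi
        exact ⟨x, ⟨hSX _ hxy 0, (hYiff x).2 ⟨y, hxy, hy⟩⟩, hx⟩
      · obtain ⟨r, hrX, hr⟩ := hXgood i
        exact ⟨r, ⟨hrX, (hYiff r).2 ⟨a, mk_right_mem_crossSg ⟨hr i₀ (Ne.symm hi), hrX⟩, haC⟩⟩, hr⟩
    obtain ⟨r, hr, hrC⟩ := (hYiff a).1 (hle haX).2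
    exact hnbr r (hSX _ hr 1) hrC hr
  let π : Fin 2 → (S →[L] Q) := fun b => (projHom L (fun _ : Fin 2 => Q) b).comp S.subtype.toHom
  -- The new algebra is the relation `S` itself, with each `C i`, `i ≠ i₀`, pulled back along both
  -- coordinates. The pairs `(r, a)` and `(a, r)` are the witnesses of criticality.
  refine ⟨S, inferInstance, inferInstance, {i // i ≠ i₀} × Fin 2, inferInstance,
    fun i => (C i.1).comap (π i.2), (IsIdempotent.pi fun _ => hQ).substructure S, ?_,
    fun i => (hC i.1).comap _, fun i => (ht i.1).comap _, ?_, ?_⟩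
  · have := Fintype.ofFinite ι
    rw [Nat.card_eq_fintype_card] at hι
    simp only [Nat.card_eq_fintype_card, Fintype.card_prod, Fintype.card_fin,
      Fintype.card_subtype_compl, Fintype.card_subtype_eq]
    -- This is m < 2(m - 1), where m ≥ 3 is needed.
    omega
  · rintro ⟨⟨i, hi⟩, b⟩
    obtain ⟨r, hrX, hr⟩ := hXgood i
    have hr₀ : r ∈ C i₀ ⊓ X := ⟨hr i₀ (Ne.symm hi), hrX⟩
    fin_cases b
    · refine ⟨⟨![r, a], mk_right_mem_crossSg hr₀⟩, ?_⟩
      rintro ⟨⟨j, hj⟩, b⟩ hne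
      fin_cases b
      · exact hr j fun h => hne (by simp [h])
      · exact haC j hj
    · refine ⟨⟨![a, r], mk_left_mem_crossSg hr₀⟩, ?_⟩
      rintro ⟨⟨j, hj⟩, b⟩ hne
      fin_cases b
      · exact haC j hj
      · exact hr j fun h => hne (by simp [h])
  · rintro ⟨⟨p, hp⟩, hpC⟩
    refine hempty (p 0) (p 1) ?_ (fun j hj => hpC ⟨⟨j, hj⟩, 0⟩) fun j hj => hpC ⟨⟨j, hj⟩, 1⟩
    have : ![p 0, p 1] = p := by funext i; fin_cases i <;> rfl
    rwa [this]

/-- A critical family of central subuniverses has at most two members. -/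
theorem IsCritical.card_le_two [Finite Q] (hQ : IsIdempotent L Q) {ι : Type} [Finite ι]
    {C : ι → L.Substructure Q} (hC : ∀ i, IsCentral (C i)) (h : IsCritical C) :
    Nat.card ι ≤ 2 := by
  by_contra hι
  obtain ⟨α, hα, hα', t, ht⟩ := exists_common_absorbs C fun i => (hC i).1
  have H : ∀ N : ℕ, ∃ (Q' : Type w) (_ : L.Structure Q') (_ : Finite Q') (ι' : Type) (_ : Finite ι')
      (C' : ι' → L.Substructure Q'), IsIdempotent L Q' ∧ N + 3 ≤ Nat.card ι' ∧
        (∀ i, IsCentral (C' i)) ∧ (∀ i, Absorbs (C' i) t) ∧ IsCritical C' := by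
    intro N
    induction N with
    | zero => exact ⟨Q, inferInstance, inferInstance, ι, inferInstance, C, hQ, by omega, hC, ht, h⟩
    | succ N ih =>
      obtain ⟨Q', i1, i2, ι', i3, C', hQ', hcard, hC', ht', h'⟩ := ih
      obtain ⟨Q'', j1, j2, ι'', j3, C'', hQ'', hcard', hC'', ht'', h''⟩ :=
        h'.exists_larger hQ' (by omega) hC' ht'
      exact ⟨Q'', j1, j2, ι'', j3, C'', hQ'', by omega, hC'', ht'', h''⟩
  obtain ⟨Q', _, _, ι', _, C', _, hcard, _, ht', h'⟩ := H (Nat.card α)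
  exact not_isCritical_of_absorbs (by omega) ht' h'

end Critical

/-! ### Consequences of lacking projective or binary absorbing subuniverses -/

section GoodTerms

variable {L : FirstOrder.Language.{u, v}}

/-- The term operation `t` is onto even if one of its arguments, in any position, is restricted to
`S`. -/
def IsGoodFor {D : Type w} [L.Structure D] (S : Set D) {α : Type} (t : L.Term α) : Prop :=
  ∀ (i : α) (e : D), ∃ x : α → D, x i ∈ S ∧ t.realize x = e

variable {D : Type w} [L.Structure D]

theorem IsGoodFor.star_left (hD : IsIdempotent L D) {S : Set D} {α β : Type} {t : L.Term α}
    (s : L.Term β) (h : IsGoodFor S t) : IsGoodFor S (star t s) := by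
  rintro ⟨i, j⟩ e
  obtain ⟨x, hx, rfl⟩ := h i e
  refine ⟨fun p => x p.1, hx, ?_⟩
  rw [realize_star]
  simp only [hD.realize_const]

theorem IsGoodFor.star_right (hD : IsIdempotent L D) {S : Set D} {α β : Type} (t : L.Term α)
    {s : L.Term β} (h : IsGoodFor S s) : IsGoodFor S (star t s) := by
  rintro ⟨i, j⟩ e
  obtain ⟨x, hx, rfl⟩ := h j e
  refine ⟨fun p => x p.2, hx, ?_⟩
  rw [realize_star]
  simp only [hD.realize_const]

/-- In an idempotent algebra without nontrivial projective subuniverses every nonempty set admits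
a good term. -/
theorem exists_isGoodFor [Finite D] (hD : IsIdempotent L D)
    (hproj : ∀ S : L.Substructure D, IsNontrivial S → ¬ IsProjective S) (S : Set D)
    (hS : S.Nonempty) :
    ∃ (α : Type) (_ : Finite α) (_ : Nonempty α) (t : L.Term α), IsGoodFor S t := by
  classical
  by_contra hbad
  -- A maximal set without a good term turns out to be a nontrivial projective subuniverse.
  obtain ⟨M, hM⟩ := (Set.toFinite {S : Set D | S.Nonempty ∧
    ¬ ∃ (α : Type) (_ : Finite α) (_ : Nonempty α) (t : L.Term α), IsGoodFor S t}).exists_maximal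
      ⟨S, hS, hbad⟩
  obtain ⟨⟨m, hm⟩, hMbad⟩ := hM.prop
  have hMuniv : M ≠ Set.univ := by
    rintro rfl
    exact hMbad ⟨Unit, inferInstance, inferInstance, Term.var (), fun _ e => ⟨fun _ => e, trivial, rfl⟩⟩
  have key : ∀ (k : ℕ) (f : L.Functions k), ∃ i : Fin k, ∀ x : Fin k → D, x i ∈ M →
      Structure.funMap f x ∈ M := by
    intro k f
    by_contra! hf
    -- An idempotent nullary operation forces `D` to be a single point, hence `M` to be everything.
    have hk : Nonempty (Fin k) := by
      by_contra hk
      rw [not_nonempty_iff] at hk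
      refine hMuniv (Set.eq_univ_of_forall fun d => ?_)
      have h1 := hD k f d
      have h2 := hD k f m
      rw [Subsingleton.elim (fun _ : Fin k => d) fun _ => m, h2] at h1
      exact h1 ▸ hm
    -- If `f` violates projectivity at every coordinate, each `T i` properly contains `M`, so
    -- maximality gives a good term for it; composing a common one with `f` yields a good term for
    -- `M`.
    let T : Fin k → Set D := fun i => {e | ∃ x : Fin k → D, x i ∈ M ∧ Structure.funMap f x = e}
    have hMT : ∀ i, M ⊆ T i := fun i d hd => ⟨fun _ => d, hd, hD k f d⟩
    have hT : ∀ i, ∃ (α : Type) (_ : Finite α) (_ : Nonempty α) (t : L.Term α),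
        IsGoodFor (T i) t := by
      intro i
      by_contra hi
      obtain ⟨x, hx, hfx⟩ := hf i
      exact hfx (hM.le_of_ge (y := T i) ⟨⟨m, hMT i hm⟩, hi⟩ (hMT i) ⟨x, hx, rfl⟩)
    obtain ⟨α, h1, h2, g, hg⟩ := exists_common_term (fun i _ t => IsGoodFor (T i) t)
      (fun _ _ _ _ s h => h.star_left hD s) (fun _ _ _ t _ h => h.star_right hD t) hT
    refine hMbad ⟨α × Fin k, inferInstance, inferInstance, star g (Term.func f Term.var), ?_⟩
    rintro ⟨j, i⟩ e
    obtain ⟨x, ⟨y, hy, hyx⟩, rfl⟩ := hg i j e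
    refine ⟨fun p => if p.1 = j then y p.2 else x p.1, by simpa using hy, ?_⟩
    rw [realize_star]
    congr 1
    funext j'
    by_cases hj : j' = j
    · subst hj
      simpa using hyx
    · simpa [hj] using hD k f (x j')
  let N : L.Substructure D := ⟨M, fun {k} f x hx => (key k f).elim fun i hi => hi x (hx i)⟩
  exact hproj N ⟨fun h => hMuniv (congrArg SetLike.coe h), ⟨m, hm⟩⟩ key

/-- A term that is good for all singletons of finitely many algebras. -/
theorem exists_common_isGoodFor {ι : Type*} [Finite ι] {D : ι → Type w} [∀ j, L.Structure (D j)]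
    [∀ j, Finite (D j)] (hD : ∀ j, IsIdempotent L (D j))
    (hproj : ∀ j, ∀ S : L.Substructure (D j), IsNontrivial S → ¬ IsProjective S) :
    ∃ (α : Type) (_ : Finite α) (_ : Nonempty α) (t : L.Term α),
      ∀ j (d : D j), IsGoodFor {d} t := by
  obtain ⟨α, h1, h2, t, ht⟩ := exists_common_term (κ := Σ j, D j)
    (fun p _ t => IsGoodFor {p.2} t) (fun p _ _ _ s h => h.star_left (hD p.1) s)
    (fun p _ _ t _ h => h.star_right (hD p.1) t)
    (fun p => exists_isGoodFor (hD p.1) (hproj p.1) _ (Set.singleton_nonempty p.2))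
  exact ⟨α, h1, h2, t, fun j d => ht ⟨j, d⟩⟩

/-- A finite product of idempotent algebras without nontrivial binary absorbing subuniverses has
no nontrivial binary absorbing subuniverses. -/
theorem mem_of_absorbsWith_pi {ι : Type*} [Finite ι] {D : ι → Type w} [∀ j, L.Structure (D j)]
    (hD : ∀ j, IsIdempotent L (D j))
    (hBA : ∀ j, ∀ S : L.Substructure (D j), IsNontrivial S → ¬ IsBinaryAbsorbing S)
    {B : L.Substructure (∀ j, D j)} {t : L.Term (Fin 2)} (ht : AbsorbsWith B t)
    {b : ∀ j, D j} (hb : b ∈ B) (g : ∀ j, D j) : g ∈ B := by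
  classical
  have hreal : ∀ {α : Type} (s : L.Term α) (c : ∀ j, D j) (j : ι) (x : α → D j),
      s.realize (fun i => Function.update c j (x i)) = Function.update c j (s.realize x) := by
    intro α s c j x
    funext j'
    rw [realize_pi]
    by_cases hj : j' = j
    · subst hj
      simp
    · simp [hj, (hD j').realize_const]
  -- By idempotence, the slice of `B` through `c` in direction `j` is a nonempty binary absorbing
  -- subuniverse of `D j`, hence all of it. Coordinates can then be changed one at a time.
  have hupd : ∀ c ∈ B, ∀ j (x : D j), Function.update c j x ∈ B := by
    intro c hc j x
    let S : L.Substructure (D j) := ⟨{y | Function.update c j y ∈ B}, fun {k} f y hy => by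
      have := Term.realize_mem (S := B) (Term.func f Term.var : L.Term (Fin k)) _ hy
      rw [hreal] at this
      exact this⟩
    have hSne : (S : Set (D j)).Nonempty := ⟨c j, show Function.update c j (c j) ∈ B by simpa⟩
    have hSabs : IsBinaryAbsorbing S := ⟨t, fun i y hy => by
      have := ht i (fun i => Function.update c j (y i)) hy
      rw [hreal] at this
      exact this⟩
    have htop : S = ⊤ := by
      by_contra hne
      exact hBA j S ⟨hne, hSne⟩ hSabs
    have : x ∈ S := htop ▸ Substructure.mem_top x
    exact this
  have := Fintype.ofFinite ι
  have H : ∀ s : Finset ι, (fun j => if j ∈ s then g j else b j) ∈ B := by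
    intro s
    induction s using Finset.induction_on with
    | empty => simpa using hb
    | insert i s hi ih =>
      convert hupd _ ih i (g i) using 1
      funext j
      by_cases hj : j = i
      · subst hj; simp
      · simp [hj]
  simpa using H Finset.univ

end GoodTerms

/-! ### Full fibres form a central subuniverse -/

section Full

variable {L : FirstOrder.Language.{u, v}}

/-- An algebra without nontrivial central subuniverses. -/
def NoCentral (L : FirstOrder.Language.{u, v}) (A : Type w) [L.Structure A] : Prop :=
  ∀ S : L.Substructure A, IsNontrivial S → ¬ IsCentral S

theorem IsPCWithoutBACP.noCentral {D : Type w} [L.Structure D] (h : IsPCWithoutBACP L D) :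
    NoCentral L D := fun S hS => (h.2 S hS).2.1

variable {Q A ι : Type*} [L.Structure Q] [L.Structure A] {D : ι → Type w} [∀ j, L.Structure (D j)]

/-- The set of all `a` such that the homomorphisms `h j` are jointly onto on the fibre of `φ`
over `a`. -/
def fullSub (hD : ∀ j, IsIdempotent L (D j)) (φ : Q →[L] A) (h : ∀ j, Q →[L] D j) :
    L.Substructure A where
  carrier := {a | ∀ g : ∀ j, D j, ∃ q, φ q = a ∧ ∀ j, h j q = g j}
  fun_mem := by
    intro k f x hx g
    choose q hq hqg using fun i => hx i g
    refine ⟨Structure.funMap f q, ?_, fun j => ?_⟩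
    · rw [φ.map_fun]
      congr 1
      exact funext hq
    · rw [(h j).map_fun, show h j ∘ q = fun _ => g j from funext fun i => hqg i j, hD j k f]

/-- A common good term absorbs: the one uncontrolled argument has fixed values in the `D j`, and the
full fibres of the other arguments supply values that make `t` hit any target. If `(a, a)` were
generated by the cross, the image in `∏ D j` of the fibre over `a` would be binary absorbing, hence
everything, and `a` would be full. -/
theorem isCentral_fullSub [Finite ι] [∀ j, Finite (D j)] (hA : IsIdempotent L A)
    (hD : ∀ j, IsIdempotent L (D j))
    (hBA : ∀ j, ∀ S : L.Substructure (D j), IsNontrivial S → ¬ IsBinaryAbsorbing S)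
    (hproj : ∀ j, ∀ S : L.Substructure (D j), IsNontrivial S → ¬ IsProjective S)
    {φ : Q →[L] A} (hφ : Function.Surjective φ) (h : ∀ j, Q →[L] D j) :
    IsCentral (fullSub hD φ h) := by
  classical
  refine isCentral_iff.2 ⟨?_, fun a ha hmem => ?_⟩
  · obtain ⟨α, h1, h2, t, ht⟩ := exists_common_isGoodFor hD hproj
    refine isAbsorbing_iff.2 ⟨α, h1, h2, t, fun i x hx g => ?_⟩
    obtain ⟨q₀, hq₀⟩ := hφ (x i)
    choose y hy hyg using fun j => ht j (h j q₀) i (g j)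
    choose q hqx hqy using fun i' : {i' // i' ≠ i} => hx i' i'.2 fun j => y j i'
    have hval : ∀ i', φ (if hi : i' ≠ i then q ⟨i', hi⟩ else q₀) = x i' ∧
        ∀ j, h j (if hi : i' ≠ i then q ⟨i', hi⟩ else q₀) = y j i' := by
      intro i'
      by_cases hi : i' = i
      · subst hi
        simpa [hq₀] using fun j => (hy j).symm
      · simpa [hi] using ⟨hqx ⟨i', hi⟩, hqy ⟨i', hi⟩⟩
    refine ⟨t.realize fun i' => if hi : i' ≠ i then q ⟨i', hi⟩ else q₀, ?_, fun j => ?_⟩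
    · rw [← HomClass.realize_term]
      congr 1
      exact funext fun i' => (hval i').1
    · rw [← HomClass.realize_term, ← hyg j]
      congr 1
      exact funext fun i' => (hval i').2 j
  · obtain ⟨γ, t, r, c, hc, H⟩ := exists_term_of_mem_crossSg ha hmem
    let P : L.Substructure (∀ j, D j) := ⟨{g | ∃ q, φ q = a ∧ ∀ j, h j q = g j},
      fun {k} f x hx => by
        choose q hq hqx using hx
        refine ⟨Structure.funMap f q, ?_, fun j => ?_⟩
        · rw [φ.map_fun, show φ ∘ q = fun _ => a from funext hq, hA]
        · rw [(h j).map_fun]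
          exact congrArg _ (funext fun i => hqx i j)⟩
    -- Merge the variables of `t` by the side of the cross they come from. The free argument is
    -- realized over the full points `c p`, the other one over `a`; one of the two rows of the
    -- identity puts the result over `a`.
    have hP : AbsorbsWith P (t.relabel fun p => if r p then (0 : Fin 2) else 1) := by
      intro b x hx
      have hrow : ∀ i : Fin 2, i ≠ b → ∃ q, φ q = a ∧ ∀ j, h j q = x i j := fun i hi => hx i hi
      choose l hlc hlx using fun (p : γ) => hc p (x b)
      fin_cases b
      · obtain ⟨q, hq, hqx⟩ := hrow 1 (by decide)
        refine ⟨t.realize fun p => if r p then l p else q, ?_, fun j => ?_⟩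
        · rw [← HomClass.realize_term]
          refine (H (fun p => if r p then a else c p) _ (fun p hp => ?_) fun p hp => ?_).2
          · simpa [hp] using hlc p
          · simpa [hp] using hq
        · rw [← HomClass.realize_term, realize_pi, Term.realize_relabel]
          congr 1
          funext p
          by_cases hp : r p
          · simpa [hp] using hlx p j
          · simpa [hp] using hqx j
      · obtain ⟨q, hq, hqx⟩ := hrow 0 (by decide)
        refine ⟨t.realize fun p => if r p then q else l p, ?_, fun j => ?_⟩
        · rw [← HomClass.realize_term]
          refine (H _ (fun p => if r p then c p else a) (fun p hp => ?_) fun p hp => ?_).1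
          · simpa [hp] using hq
          · simpa [hp] using hlc p
        · rw [← HomClass.realize_term, realize_pi, Term.realize_relabel]
          congr 1
          funext p
          by_cases hp : r p
          · simpa [hp] using hqx j
          · simpa [hp] using hlx p j
    obtain ⟨q₀, hq₀⟩ := hφ a
    exact ha fun g => mem_of_absorbsWith_pi hD hBA hP (b := fun j => h j q₀) ⟨q₀, hq₀, fun _ => rfl⟩ g

/-- If `A` has no nontrivial central subuniverse, then a single full fibre makes all fibres
full. -/
theorem forall_full_of_exists [Finite ι] [∀ j, Finite (D j)] (hA : IsIdempotent L A)
    (hAC : NoCentral L A) (hD : ∀ j, IsIdempotent L (D j)) (hPC : ∀ j, IsPCWithoutBACP L (D j))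
    {φ : Q →[L] A} (hφ : Function.Surjective φ) (h : ∀ j, Q →[L] D j)
    (hex : ∃ a, ∀ g : ∀ j, D j, ∃ q, φ q = a ∧ ∀ j, h j q = g j) (a : A) (g : ∀ j, D j) :
    ∃ q, φ q = a ∧ ∀ j, h j q = g j := by
  have hC := isCentral_fullSub hA hD (fun j S hS => ((hPC j).2 S hS).1)
    (fun j S hS => ((hPC j).2 S hS).2.2) hφ h
  have htop : fullSub hD φ h = ⊤ := by
    by_contra hne
    exact hAC _ ⟨hne, hex⟩ hC
  have : a ∈ fullSub hD φ h := htop ▸ Substructure.mem_top a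
  exact this g

end Full

/-! ### Joint surjectivity of homomorphisms onto PC algebras -/

section Joint

variable {L : FirstOrder.Language.{u, v}}

theorem realize_congr_hom {Q A α : Type*} [L.Structure Q] [L.Structure A] (φ : Q →[L] A)
    (t : L.Term α) {x y : α → Q} (h : ∀ i, φ (x i) = φ (y i)) :
    φ (t.realize x) = φ (t.realize y) := by
  rw [← HomClass.realize_term, ← HomClass.realize_term]
  congr 1
  exact funext h

/-- A homomorphism onto a PC algebra without BACP either factors through `φ` or is jointly
surjective with `φ`. -/
theorem factor_or_jointly_surjective {Q : Type*} {A : Type*} {D : Type w} [L.Structure Q]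
    [L.Structure A] [L.Structure D] [Finite Q] (hQ : IsIdempotent L Q) (hAC : NoCentral L A)
    (hPC : IsPCWithoutBACP L D) {φ : Q →[L] A} (hφ : Function.Surjective φ) {h : Q →[L] D}
    (hh : Function.Surjective h) :
    (∀ q q', φ q = φ q' → h q = h q') ∨ ∀ a d, ∃ q, φ q = a ∧ h q = d := by
  classical
  by_cases hfac : ∀ q q', φ q = φ q' → h q = h q'
  · exact Or.inl hfac
  right
  push Not at hfac
  obtain ⟨q, q', hφq, hhq⟩ := hfac
  have : Finite D := Finite.of_surjective h hh
  have e := Finite.equivFin D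
  have : Nonempty D := ⟨h q⟩
  -- Encode each `d` as a tuple over the two values `h q`, `h q'`; a polynomial decodes it. Lifted
  -- to `Q` with `q`, `q'` as inputs, it reaches every value of `h` inside one fibre of `φ`, since
  -- `φ q = φ q'`.
  let v : D → Fin (Nat.card D) → D := fun d i => if e d = i then h q else h q'
  have hv : Function.Injective v := by
    intro d d' hdd
    have := congrFun hdd (e d)
    by_contra hne
    have hne' : e d' ≠ e d := fun h => hne (e.injective h).symm
    simp only [v, if_true, if_neg hne'] at this
    exact hhq this
  obtain ⟨t, ht⟩ := hPC.1 (Nat.card D) (Function.invFun v)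
  choose l hl using hh
  let r : D → Q := fun d => t.realize (Sum.elim l fun i => if e d = i then q else q')
  have hr : ∀ d, h (r d) = d := by
    intro d
    have h1 := ht (v d)
    rw [Function.leftInverse_invFun hv d] at h1
    refine Eq.trans ?_ h1
    rw [← HomClass.realize_term]
    congr 1
    funext x
    rcases x with x | i
    · exact hl x
    · simp only [Function.comp, Sum.elim_inr, v]
      split_ifs <;> rfl
  have hφr : ∀ d d', φ (r d) = φ (r d') := by
    intro d d'
    refine realize_congr_hom φ t fun x => ?_
    rcases x with x | i
    · rfl
    · simp only [Sum.elim_inr]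
      split_ifs <;> simp [hφq]
  intro a d
  obtain ⟨p, hp, hpd⟩ := forall_full_of_exists (ι := Unit) (D := fun _ => D)
    (hQ.of_surjective φ hφ) hAC (fun _ => hQ.of_surjective h fun d => ⟨l d, hl d⟩) (fun _ => hPC) hφ
    (fun _ => h) ⟨φ (r (h q)), fun g => ⟨r (g ()), hφr _ _, fun _ => hr _⟩⟩ a fun _ => d
  exact ⟨p, hp, hpd ()⟩

/-- A polynomially complete algebra does not satisfy the term condition unless it is trivial. -/
theorem subsingleton_of_latin {Q X Y : Type*} {D : Type w} [L.Structure Q] [L.Structure X]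
    [L.Structure Y] [L.Structure D] (hPC : IsPolynomiallyComplete L D) {f : Q →[L] X}
    {h : Q →[L] D} {k : Q →[L] Y} (hh : Function.Surjective h)
    (hf : ∀ q q', h q = h q' → k q = k q' → f q = f q')
    (hfk : ∀ q q', f q = f q' → k q = k q' → h q = h q')
    (hk : ∀ d d', ∃ q q', h q = d ∧ h q' = d' ∧ k q = k q')
    (hf' : ∀ d d', ∃ q q', h q = d ∧ h q' = d' ∧ f q = f q') : Subsingleton D := by
  classical
  refine ⟨fun d d' => ?_⟩
  by_contra hne
  -- This operation ignores its first argument when the second is `d` and returns it when the second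
  -- is `d'`. The kernel conditions carry the first behaviour over to the second, forcing `d = d'`.
  obtain ⟨t, ht⟩ := hPC 2 fun x => if x 1 = d then d else x 0
  obtain ⟨q, q', rfl, rfl, hq⟩ := hk d d'
  obtain ⟨p, p', hp, hp', hpp⟩ := hf' (h q) (h q')
  choose l hl using hh
  let r : Q → Q → Q := fun x y => t.realize (Sum.elim l ![x, y])
  have hr : ∀ x y, h (r x y) = if h y = h q then h q else h x := by
    intro x y
    have := ht ![h x, h y]
    simp only [Matrix.cons_val_zero, Matrix.cons_val_one] at this
    refine Eq.trans ?_ this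
    rw [← HomClass.realize_term]
    congr 1
    funext z
    rcases z with z | i
    · exact hl z
    · fin_cases i <;> rfl
  have hf₁ : f (r q p) = f (r q' p) := by
    refine hf _ _ (by simp [hr, hp]) (realize_congr_hom k t ?_)
    rintro (z | z)
    · rfl
    · fin_cases z
      exacts [hq, rfl]
  have hf₂ : ∀ x, f (r x p) = f (r x p') := by
    refine fun x => realize_congr_hom f t ?_
    rintro (z | z)
    · rfl
    · fin_cases z
      exacts [rfl, hpp]
  have hk₂ : k (r q p') = k (r q' p') := by
    refine realize_congr_hom k t ?_
    rintro (z | z)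
    · rfl
    · fin_cases z
      exacts [hq, rfl]
  have := hfk _ _ ((hf₂ q).symm.trans (hf₁.trans (hf₂ q'))) hk₂
  rw [hr, hr, hp', if_neg (Ne.symm hne), if_neg (Ne.symm hne)] at this
  exact hne this

/-- The restriction of a homomorphism to a subuniverse. -/
def restrict {Q A : Type*} [L.Structure Q] [L.Structure A] (φ : Q →[L] A) (S : L.Substructure Q) :
    S →[L] A :=
  φ.comp S.subtype.toHom

/-- Pairwise joint surjectivity of `φ` and two homomorphisms onto PC algebras without BACP implies
joint surjectivity. -/
theorem jointly_surjective_triple {Q A ι : Type*} {D : ι → Type w} [L.Structure Q]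
    [L.Structure A] [∀ j, L.Structure (D j)] [Finite Q] (hQ : IsIdempotent L Q)
    (hAC : NoCentral L A) (hPC : ∀ j, IsPCWithoutBACP L (D j)) {φ : Q →[L] A}
    (hφ : Function.Surjective φ) {h : ∀ j, Q →[L] D j} (hh : ∀ j, Function.Surjective (h j))
    {i j : ι} (hi : ∀ a d, ∃ q, φ q = a ∧ h i q = d) (hj : ∀ a d, ∃ q, φ q = a ∧ h j q = d)
    (hij : ∀ d e, ∃ q, h i q = d ∧ h j q = e) (a : A) (d : D i) (e : D j) :
    ∃ q, φ q = a ∧ h i q = d ∧ h j q = e := by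
  have hA : IsIdempotent L A := hQ.of_surjective φ hφ
  have hD : ∀ j, IsIdempotent L (D j) := fun j => hQ.of_surjective (h j) (hh j)
  have hfin : ∀ j, Finite (D j) := fun j => Finite.of_surjective (h j) (hh j)
  by_cases hex : ∃ a, ∀ d e, ∃ q, φ q = a ∧ h i q = d ∧ h j q = e
  · obtain ⟨a₀, ha₀⟩ := hex
    obtain ⟨q, hq, hqb⟩ := forall_full_of_exists (D := fun b : Fin 2 => D (![i, j] b)) hA hAC
      (fun b => hD _) (fun b => hPC _) hφ (fun b => h (![i, j] b))
      ⟨a₀, fun g => by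
        obtain ⟨q, h1, h2, h3⟩ := ha₀ (g 0) (g 1)
        refine ⟨q, h1, fun b => ?_⟩
        fin_cases b
        exacts [h2, h3]⟩ a
      (fun b => match b with
        | 0 => d
        | 1 => e)
    exact ⟨q, hq, hqb 0, hqb 1⟩
  · push Not at hex
    -- On a fibre of `φ` both maps are onto but not jointly onto, so by the dichotomy each factors
    -- through the other. The kernels then satisfy the hypotheses of `subsingleton_of_latin`, so `D
    -- i` is trivial.
    have hker : ∀ q q', φ q = φ q' → (h i q = h i q' ↔ h j q = h j q') := by
      intro q q' hqq
      obtain ⟨d₀, e₀, hde⟩ := hex (φ q)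
      have hFi : Function.Surjective (restrict (h i) (fiber hA φ (φ q))) := fun d => by
        obtain ⟨p, hp, hpd⟩ := hi (φ q) d
        exact ⟨⟨p, hp⟩, hpd⟩
      have hFj : Function.Surjective (restrict (h j) (fiber hA φ (φ q))) := fun d => by
        obtain ⟨p, hp, hpd⟩ := hj (φ q) d
        exact ⟨⟨p, hp⟩, hpd⟩
      have hF := hQ.substructure (fiber hA φ (φ q))
      constructor
      · rcases factor_or_jointly_surjective hF (hPC i).noCentral (hPC j) hFi hFj with h1 | h1
        · exact h1 ⟨q, rfl⟩ ⟨q', hqq.symm⟩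
        · obtain ⟨⟨p, hp⟩, h2, h3⟩ := h1 d₀ e₀
          exact absurd h3 (hde p hp h2)
      · rcases factor_or_jointly_surjective hF (hPC j).noCentral (hPC i) hFj hFi with h1 | h1
        · exact h1 ⟨q, rfl⟩ ⟨q', hqq.symm⟩
        · obtain ⟨⟨p, hp⟩, h2, h3⟩ := h1 e₀ d₀
          exact absurd h2 (hde p hp h3)
    have : Subsingleton (D i) := by
      refine subsingleton_of_latin (f := h j) (k := φ) (hPC i).1 (hh i)
        (fun q q' h1 h2 => (hker q q' h2).1 h1) (fun q q' h1 h2 => (hker q q' h2).2 h1)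
        (fun d d' => ?_) fun d d' => ?_
      · obtain ⟨q, hq⟩ := hi a d
        obtain ⟨q', hq'⟩ := hi a d'
        exact ⟨q, q', hq.2, hq'.2, hq.1.trans hq'.1.symm⟩
      · obtain ⟨q, hq⟩ := hij d e
        obtain ⟨q', hq'⟩ := hij d' e
        exact ⟨q, q', hq.1, hq'.1, hq.2.trans hq'.2.symm⟩
    obtain ⟨q, hq, hqe⟩ := hj a e
    exact ⟨q, hq, Subsingleton.elim _ _, hqe⟩

/-- Homomorphisms onto PC algebras without BACP that are pairwise jointly surjective are jointly
surjective. -/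
theorem jointly_surjective_of_pairwise {ι : Type*} {D : ι → Type w} [∀ j, L.Structure (D j)]
    (hPC : ∀ j, IsPCWithoutBACP L (D j)) (s : Finset ι) :
    ∀ {Q : Type z} [L.Structure Q] [Finite Q] [Nonempty Q], IsIdempotent L Q →
      ∀ {h : ∀ j, Q →[L] D j}, (∀ j ∈ s, Function.Surjective (h j)) →
      (∀ i ∈ s, ∀ j ∈ s, i ≠ j → ∀ d e, ∃ q, h i q = d ∧ h j q = e) →
      ∀ g : ∀ j, D j, ∃ q, ∀ j ∈ s, h j q = g j := by
  classical
  induction s using Finset.induction_on with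
  | empty => exact fun {Q} _ _ _ _ _ _ _ _ => ⟨Classical.arbitrary Q, by simp⟩
  | insert i s his ih =>
    intro Q _ _ _ hQ h hh hpair g
    have hi : i ∈ insert i s := Finset.mem_insert_self i s
    have hs : ∀ j ∈ s, j ∈ insert i s := fun j hj => Finset.mem_insert_of_mem hj
    have hne : ∀ j ∈ s, i ≠ j := fun j hj h => his (h ▸ hj)
    have hDi : IsIdempotent L (D i) := hQ.of_surjective (h i) (hh i hi)
    obtain ⟨q₀, hq₀⟩ := hh i hi (g i)
    -- Induct inside the fibre of `h i`: the triple lemma says that the remaining maps stay pairwise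
    -- jointly onto there.
    have : Nonempty (fiber hDi (h i) (g i)) := ⟨⟨q₀, hq₀⟩⟩
    obtain ⟨q, hq⟩ := ih (hQ.substructure (fiber hDi (h i) (g i)))
      (h := fun j => restrict (h j) (fiber hDi (h i) (g i)))
      (fun j hj d => by
        obtain ⟨q, h1, h2⟩ := hpair i hi j (hs j hj) (hne j hj) (g i) d
        exact ⟨⟨q, h1⟩, h2⟩)
      (fun j hj k hk hjk d e => by
        obtain ⟨q, h1, h2⟩ := jointly_surjective_triple (D := fun j : {j // j ∈ s} => D j) hQ
          (hPC i).noCentral (fun j => hPC j) (hh i hi) (h := fun j => h j)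
          (fun j => hh j (hs j j.2)) (i := ⟨j, hj⟩) (j := ⟨k, hk⟩)
          (hpair i hi j (hs j hj) (hne j hj)) (hpair i hi k (hs k hk) (hne k hk))
          (hpair j (hs j hj) k (hs k hk) hjk) (g i) d e
        exact ⟨⟨q, h1⟩, h2⟩) g
    refine ⟨q, fun j hj => ?_⟩
    rcases Finset.mem_insert.1 hj with rfl | hj
    · exact q.2
    · exact hq j hj

end Joint

/-! ### PC subuniverses as systems of equations -/

section PC

variable {L : FirstOrder.Language.{u, v}} {Q : Type w} [L.Structure Q]

/-- `B` is the set of solutions of a finite system of equations `h j q = d j`, where the `h j` are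
homomorphisms onto PC algebras without BACP. -/
def IsPCSystem (B : L.Substructure Q) : Prop :=
  ∃ (ι : Type) (_ : Finite ι) (D : ι → Type w) (_ : ∀ j, L.Structure (D j))
    (h : ∀ j, Q →[L] D j) (d : ∀ j, D j), (∀ j, IsPCWithoutBACP L (D j)) ∧
      (∀ j, Function.Surjective (h j)) ∧ (B : Set Q) = {q | ∀ j, h j q = d j}

theorem IsPCSystem.comap {A : Type w} [L.Structure A] {φ : Q →[L] A}
    (hφ : Function.Surjective φ) {B : L.Substructure A} (hB : IsPCSystem B) :
    IsPCSystem (B.comap φ) := by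
  obtain ⟨ι, h1, D, h2, h, d, hPC, hh, hBd⟩ := hB
  refine ⟨ι, h1, D, h2, fun j => (h j).comp φ, d, hPC, fun j => (hh j).comp hφ, ?_⟩
  ext q
  exact Set.ext_iff.1 hBd (φ q)

theorem IsPCSystem.iInf {κ : Type} [Finite κ] {B : κ → L.Substructure Q}
    (hB : ∀ i, IsPCSystem (B i)) : IsPCSystem (⨅ i, B i) := by
  choose ι h1 D h2 h d hPC hh hBd using hB
  refine ⟨Σ i, ι i, inferInstance, fun p => D p.1 p.2, fun p => h2 p.1 p.2, fun p => h p.1 p.2,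
    fun p => d p.1 p.2, fun p => hPC p.1 p.2, fun p => hh p.1 p.2, ?_⟩
  ext q
  rw [SetLike.mem_coe, Substructure.mem_iInf]
  have : ∀ i, q ∈ B i ↔ ∀ j, h i j q = d i j := fun i => Set.ext_iff.1 (hBd i) q
  simp only [this, Set.mem_ofPred_eq, Sigma.forall]

theorem isPCSystem_top : IsPCSystem (⊤ : L.Substructure Q) :=
  ⟨Empty, inferInstance, fun j => j.elim, fun j => j.elim, fun j => j.elim, fun j => j.elim,
    fun j => j.elim, fun j => j.elim, by ext; simp⟩

/-- Two homomorphisms onto PC algebras without BACP have the same kernel or are jointly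
surjective. -/
theorem ker_eq_or_jointly_surjective [Finite Q] (hQ : IsIdempotent L Q) {D E : Type w}
    [L.Structure D] [L.Structure E] (hD : IsPCWithoutBACP L D) (hE : IsPCWithoutBACP L E)
    {h : Q →[L] D} (hh : Function.Surjective h) {k : Q →[L] E} (hk : Function.Surjective k) :
    (∀ q q', h q = h q' ↔ k q = k q') ∨ ∀ d e, ∃ q, h q = d ∧ k q = e := by
  rcases factor_or_jointly_surjective hQ hD.noCentral hE hh hk with h1 | h1
  · rcases factor_or_jointly_surjective hQ hE.noCentral hD hk hh with h2 | h2
    · exact Or.inl fun q q' => ⟨h1 q q', h2 q q'⟩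
    · exact Or.inr fun d e => (h2 e d).imp fun q hq => hq.symm
  · exact Or.inr h1

/-- In a finite family of homomorphisms onto PC algebras without BACP one can choose
representatives of the kernels; these are pairwise jointly surjective. -/
theorem exists_kernel_representatives [Finite Q] (hQ : IsIdempotent L Q) {ι : Type} [Finite ι]
    {D : ι → Type w} [∀ j, L.Structure (D j)] (hPC : ∀ j, IsPCWithoutBACP L (D j))
    {h : ∀ j, Q →[L] D j} (hh : ∀ j, Function.Surjective (h j)) :
    ∃ (κ : Type) (_ : Finite κ) (r : κ → ι) (c : ι → κ),
      (∀ j q q', h j q = h j q' ↔ h (r (c j)) q = h (r (c j)) q') ∧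
      ∀ i j, i ≠ j → ∀ d e, ∃ q, h (r i) q = d ∧ h (r j) q = e := by
  let s : Setoid ι := ⟨fun i j => ∀ q q', h i q = h i q' ↔ h j q = h j q',
    ⟨fun _ _ _ => Iff.rfl, fun H q q' => (H q q').symm, fun H H' q q' => (H q q').trans (H' q q')⟩⟩
  refine ⟨Quotient s, inferInstance, Quotient.out, Quotient.mk s, fun j => ?_, fun i j hij => ?_⟩
  · exact fun q q' => (Quotient.exact (Quotient.out_eq (Quotient.mk s j)) q q').symm
  · refine (ker_eq_or_jointly_surjective hQ (hPC _) (hPC _) (hh _) (hh _)).resolve_left fun H => ?_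
    refine hij ?_
    rw [← Quotient.out_eq i, ← Quotient.out_eq j]
    exact Quotient.sound H

/-- Equations with the same kernel are equivalent once the system has a solution `b`, so one for
each kernel suffices. -/
theorem IsPCSystem.exists_pairwise [Finite Q] (hQ : IsIdempotent L Q) {B : L.Substructure Q}
    (hB : IsPCSystem B) {b : Q} (hb : b ∈ B) :
    ∃ (ι : Type) (_ : Finite ι) (D : ι → Type w) (_ : ∀ j, L.Structure (D j))
      (h : ∀ j, Q →[L] D j), (∀ j, IsPCWithoutBACP L (D j)) ∧
        (∀ j, Function.Surjective (h j)) ∧ (∀ q, q ∈ B ↔ ∀ j, h j q = h j b) ∧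
        ∀ i j, i ≠ j → ∀ d e, ∃ q, h i q = d ∧ h j q = e := by
  obtain ⟨ι, h1, D, h2, h, d, hPC, hh, hBd⟩ := hB
  obtain ⟨κ, h3, r, c, hrc, hpair⟩ := exists_kernel_representatives hQ hPC hh
  have hmem : ∀ q, q ∈ B ↔ ∀ j, h j q = d j := fun q => Set.ext_iff.1 hBd q
  refine ⟨κ, h3, fun i => D (r i), fun i => h2 (r i), fun i => h (r i), fun i => hPC _,
    fun i => hh _, fun q => ?_, hpair⟩
  rw [hmem] at hb ⊢
  constructor
  · exact fun hq i => (hq _).trans (hb _).symm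
  · exact fun hq j => (((hrc j q b).2 (hq (c j)))).trans (hb j)

/-- The homomorphism `a ↦ a / σ`. -/
def Congruence.mkHom [L.IsAlgebraic] (σ : Congruence L Q) : Q →[L] σ.Factor where
  toFun := Quotient.mk σ.toSetoid
  map_fun' := fun f x => (σ.funMap_factor f x).symm
  map_rel' := fun r => isEmptyElim r

theorem IsPC.eq_empty_or_isPCSystem [L.IsAlgebraic] {B : L.Substructure Q} (hB : IsPC B) :
    (B : Set Q) = ∅ ∨ IsPCSystem B := by
  classical
  rcases hB with rfl | hB | ⟨σ, ⟨a, ha⟩, s, D, hS, hPC, ⟨e⟩⟩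
  · exact Or.inr isPCSystem_top
  · exact Or.inl hB
  right
  let H : Q →[L] (∀ j, D j) := e.toHom.comp σ.mkHom
  have hH : Function.Surjective H := e.surjective.comp Quotient.mk_surjective
  refine ⟨Fin s, inferInstance, D, hS, fun j => (projHom L D j).comp H, fun j => H a j, hPC,
    fun j d => ?_, ?_⟩
  · obtain ⟨q, hq⟩ := hH (Function.update (H a) j d)
    refine ⟨q, ?_⟩
    exact (congrFun hq j).trans (Function.update_self j d (H a))
  · rw [ha]
    ext q
    constructor
    · intro hq j
      have : H q = H a := congrArg e (Quotient.sound (s := σ.toSetoid) hq)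
      exact congrFun this j
    · intro hq
      have : H q = H a := funext hq
      exact Quotient.exact (s := σ.toSetoid) (e.injective this)

/-- The kernel of a homomorphism. -/
def kerCongruence {A : Type*} [L.Structure A] (φ : Q →[L] A) : Congruence L Q where
  toSetoid := Setoid.ker φ
  preserved := by
    intro k f x y hxy
    change φ _ = φ _
    rw [φ.map_fun, φ.map_fun]
    congr 1
    exact funext hxy

theorem nonempty_factor_equiv [L.IsAlgebraic] {A : Type*} [L.Structure A] {φ : Q →[L] A}
    (hφ : Function.Surjective φ) : Nonempty ((kerCongruence φ).Factor ≃[L] A) := by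
  let F : (kerCongruence φ).Factor → A := Quotient.lift φ fun _ _ h => h
  have hF : Function.Bijective F := by
    constructor
    · rintro ⟨x⟩ ⟨y⟩ hxy
      exact Quotient.sound (s := (kerCongruence φ).toSetoid) hxy
    · exact fun a => (hφ a).imp' (Quotient.mk _) fun q hq => hq
  refine ⟨{ Equiv.ofBijective F hF with map_fun' := ?_, map_rel' := fun r => isEmptyElim r }⟩
  intro n f x
  obtain ⟨y, rfl⟩ : ∃ y : Fin n → Q, x = fun i => Quotient.mk (kerCongruence φ).toSetoid (y i) :=
    ⟨fun i => (x i).out, funext fun i => (Quotient.out_eq (x i)).symm⟩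
  rw [Congruence.funMap_factor]
  exact φ.map_fun f y

/-- The homomorphisms of a reduced system are jointly onto, so together they identify a factor of
`Q` with the whole product of the `D j`. -/
theorem IsPCSystem.isPC [L.IsAlgebraic] [Finite Q] (hQ : IsIdempotent L Q) {B : L.Substructure Q}
    (hB : IsPCSystem B) : IsPC B := by
  classical
  rcases (B : Set Q).eq_empty_or_nonempty with hemp | ⟨b, hb⟩
  · exact Or.inr (Or.inl hemp)
  obtain ⟨ι, h1, D, h2, h, hPC, hh, hBh, hpair⟩ := hB.exists_pairwise hQ hb
  have := Fintype.ofFinite ι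
  have : Nonempty Q := ⟨b⟩
  have e := Finite.equivFin ι
  let H : Q →[L] (∀ k : Fin (Nat.card ι), D (e.symm k)) :=
    { toFun := fun q k => h _ q
      map_fun' := fun f x => funext fun k => (h _).map_fun f x
      map_rel' := fun r => isEmptyElim r }
  have hH : Function.Surjective H := by
    intro g
    obtain ⟨q, hq⟩ := jointly_surjective_of_pairwise (D := fun k => D (e.symm k))
      (fun k => hPC _) Finset.univ hQ (h := fun k => h (e.symm k)) (fun k _ => hh _)
      (fun i _ j _ hij => hpair _ _ fun h => hij (e.symm.injective h)) g
    exact ⟨q, funext fun k => hq k (Finset.mem_univ k)⟩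
  refine Or.inr (Or.inr ⟨kerCongruence H, ⟨b, ?_⟩, Nat.card ι, fun k => D (e.symm k),
    inferInstance, fun k => hPC _, nonempty_factor_equiv hH⟩)
  ext q
  rw [SetLike.mem_coe, hBh]
  constructor
  · exact fun hq => funext fun k => hq _
  · intro hq j
    have := congrFun (show H q = H b from hq) (e j)
    have h3 : ∀ i, i = j → h i q = h i b → h j q = h j b := by
      rintro i rfl h
      exact h
    exact h3 _ (e.symm_apply_apply j) this

theorem isPC_of_eq_empty [L.IsAlgebraic] {B : L.Substructure Q} (h : (B : Set Q) = ∅) : IsPC B :=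
  Or.inr (Or.inl h)

theorem IsPC.comap [L.IsAlgebraic] [Finite Q] (hQ : IsIdempotent L Q) {A : Type w} [L.Structure A]
    {φ : Q →[L] A} (hφ : Function.Surjective φ) {B : L.Substructure A} (hB : IsPC B) :
    IsPC (B.comap φ) := by
  rcases hB.eq_empty_or_isPCSystem with h | h
  · exact isPC_of_eq_empty (by rw [Substructure.coe_comap, h, Set.preimage_empty])
  · exact (h.comap hφ).isPC hQ

theorem IsPC.iInf [L.IsAlgebraic] [Finite Q] (hQ : IsIdempotent L Q) {κ : Type} [Finite κ]
    {B : κ → L.Substructure Q} (hB : ∀ i, IsPC (B i)) : IsPC (⨅ i, B i) := by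
  by_cases hemp : ∃ i, (B i : Set Q) = ∅
  · obtain ⟨i, hi⟩ := hemp
    refine isPC_of_eq_empty (Set.subset_eq_empty ?_ hi)
    exact SetLike.coe_subset_coe.2 (iInf_le B i)
  · push Not at hemp
    refine (IsPCSystem.iInf fun i => ?_).isPC hQ
    exact (hB i).eq_empty_or_isPCSystem.resolve_left (hemp i).ne_empty

/-- A homomorphism onto an algebra without nontrivial central subuniverses maps PC subuniverses to
PC subuniverses. -/
theorem IsPC.map [L.IsAlgebraic] [Finite Q] (hQ : IsIdempotent L Q) {A : Type w} [L.Structure A]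
    (hAC : NoCentral L A) {φ : Q →[L] A} (hφ : Function.Surjective φ) {B : L.Substructure Q}
    (hB : IsPC B) : IsPC (B.map φ) := by
  classical
  have hA : IsIdempotent L A := hQ.of_surjective φ hφ
  have : Finite A := Finite.of_surjective φ hφ
  rcases (B : Set Q).eq_empty_or_nonempty with hemp | ⟨b, hb⟩
  · exact isPC_of_eq_empty (by rw [Substructure.coe_map, hemp, Set.image_empty])
  have hBsys := hB.eq_empty_or_isPCSystem.resolve_left (Set.Nonempty.ne_empty ⟨b, hb⟩)
  obtain ⟨ι, h1, D, h2, h, hPC, hh, hBh, hpair⟩ := hBsys.exists_pairwise hQ hb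
  have := Fintype.ofFinite ι
  -- Equations that factor through `φ` descend to `A` and define the image; the others can be solved
  -- simultaneously in every fibre of `φ`, so they impose nothing on `A`.
  let p : ι → Prop := fun j => ∀ q q', φ q = φ q' → h j q = h j q'
  have hp : ∀ j, ¬ p j → ∀ a d, ∃ q, φ q = a ∧ h j q = d := fun j hj =>
    (factor_or_jointly_surjective hQ hAC (hPC j) hφ (hh j)).resolve_left hj
  choose l hl using hφ
  let h' : ∀ j : {j // p j}, A →[L] D j := fun j =>
    { toFun := fun a => h j (l a)
      map_fun' := fun f x => by
        refine Eq.trans ?_ ((h j).map_fun f (l ∘ x))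
        refine j.2 _ _ ?_
        rw [hl, φ.map_fun]
        congr 1
        exact funext fun i => (hl (x i)).symm
      map_rel' := fun r => isEmptyElim r }
  have hh' : ∀ (j : {j // p j}) q, h' j (φ q) = h j q := fun j q => j.2 _ _ (hl _)
  refine IsPCSystem.isPC hA ⟨{j // p j}, inferInstance, fun j => D j, fun j => h2 j, h',
    fun j => h j b, fun j => hPC j, fun j d => ?_, ?_⟩
  · obtain ⟨q, hq⟩ := hh j d
    exact ⟨φ q, (hh' j q).trans hq⟩
  ext a
  rw [SetLike.mem_coe, Substructure.mem_map]
  constructor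
  · rintro ⟨q, hq, rfl⟩ j
    rw [hh']
    exact (hBh q).1 hq j
  · intro ha
    have : Nonempty (fiber hA φ a) := ⟨⟨l a, hl a⟩⟩
    obtain ⟨⟨q, hqa⟩, hq⟩ := jointly_surjective_of_pairwise (D := fun j : {j // ¬ p j} => D j)
      (fun j => hPC j) Finset.univ (hQ.substructure (fiber hA φ a))
      (h := fun j => restrict (h j) (fiber hA φ a))
      (fun j _ d => by
        obtain ⟨q, h3, h4⟩ := hp j j.2 a d
        exact ⟨⟨q, h3⟩, h4⟩)
      (fun i _ j _ hij d e => by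
        obtain ⟨q, h3, h4⟩ := jointly_surjective_triple hQ hAC hPC (fun a => ⟨l a, hl a⟩) hh
          (hp i i.2) (hp j j.2) (hpair i j fun h => hij (Subtype.ext h)) a d e
        exact ⟨⟨q, h3⟩, h4⟩) fun j => h j b
    refine ⟨q, (hBh q).2 fun j => ?_, hqa⟩
    by_cases hj : p j
    · have h3 := ha ⟨j, hj⟩
      rw [← show φ q = a from hqa, hh'] at h3
      exact h3
    · exact hq ⟨j, hj⟩ (Finset.mem_univ _)

/-- A critical family of PC subuniverses has at most two members. -/
theorem IsCritical.card_le_two_of_isPC [L.IsAlgebraic] [Finite Q] (hQ : IsIdempotent L Q)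
    {κ : Type} [Finite κ] {B : κ → L.Substructure Q} (hB : ∀ i, IsPC (B i))
    (hcrit : IsCritical B) : Nat.card κ ≤ 2 := by
  classical
  by_contra hcard
  have := Fintype.ofFinite κ
  rw [Nat.card_eq_fintype_card, not_le] at hcard
  -- With three members, criticality at a third index makes any two of them meet.
  have htwo : ∀ i j : κ, ∃ q, q ∈ B i ∧ q ∈ B j := by
    intro i j
    obtain ⟨k, hk⟩ : ∃ k, k ∉ ({i, j} : Finset κ) := by
      by_contra! hk
      have h1 : Finset.univ.card ≤ ({i, j} : Finset κ).card :=
        Finset.card_le_card fun k _ => hk k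
      have h2 : ({i, j} : Finset κ).card ≤ 2 := Finset.card_le_two
      rw [Finset.card_univ] at h1
      omega
    obtain ⟨q, hq⟩ := hcrit.1 k
    simp only [Finset.mem_insert, Finset.mem_singleton, not_or] at hk
    exact ⟨q, hq i (Ne.symm hk.1), hq j (Ne.symm hk.2)⟩
  have hsys : ∀ i, IsPCSystem (B i) := fun i => (hB i).eq_empty_or_isPCSystem.resolve_left <| by
    obtain ⟨q, hq, _⟩ := htwo i i
    exact Set.Nonempty.ne_empty ⟨q, hq⟩
  choose ι h1 D h2 h d hPC hh hBd using hsys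
  have hmem : ∀ i q, q ∈ B i ↔ ∀ j, h i j q = d i j := fun i q => Set.ext_iff.1 (hBd i) q
  obtain ⟨κ', h3, r, c, hrc, hpair⟩ := exists_kernel_representatives hQ (ι := Σ i, ι i)
    (D := fun p => D p.1 p.2) (fun p => hPC p.1 p.2) (h := fun p => h p.1 p.2)
    (fun p => hh p.1 p.2)
  have := Fintype.ofFinite κ'
  obtain ⟨i₀⟩ : Nonempty κ := Fintype.card_pos_iff.1 (by omega)
  obtain ⟨q₀, _⟩ := hcrit.1 i₀
  have : Nonempty Q := ⟨q₀⟩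
  obtain ⟨q, hq⟩ := jointly_surjective_of_pairwise (D := fun k => D (r k).1 (r k).2)
    (fun k => hPC _ _) Finset.univ hQ (h := fun k => h (r k).1 (r k).2) (fun k _ => hh _ _)
    (fun i _ j _ hij => hpair i j hij) fun k => d (r k).1 (r k).2
  refine hcrit.2 ⟨q, fun i => (hmem i q).2 fun j => ?_⟩
  -- The common point `x` shows that an equation and its kernel representative prescribe the same
  -- block, so solving the representatives solves all.
  obtain ⟨x, hxi, hxr⟩ := htwo i (r (c ⟨i, j⟩)).1
  rw [hmem] at hxi hxr
  rw [← hxi j]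
  exact (hrc ⟨i, j⟩ q x).2 ((hq _ (Finset.mem_univ _)).trans (hxr _).symm)

end PC

end StrongSub

/-! ### Reduction to families of subuniverses of `R` -/

theorem mainTheorem8 {L : FirstOrder.Language} [L.IsAlgebraic]
    (n : ℕ) (hn : 2 ≤ n) (A : Fin n → Type*)
    [∀ i, L.Structure (A i)] [∀ i, Finite (A i)]
    (hidem : ∀ i, StrongSub.IsIdempotent L (A i))
    (R : L.Substructure (∀ i, A i))
    (hR : StrongSub.IsSubdirect (R : Set (∀ i, A i)))
    (T : StrongSub.StrongType L)
    (B : ∀ i, L.Substructure (A i))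
    (hB : ∀ i, StrongSub.IsOfType T (B i)) :
    -- `R ∩ (B₁ × ⋯ × Bₙ)`, as a subuniverse of the algebra `R`
    StrongSub.IsOfType T ((StrongSub.prodSub B).comap R.subtype.toHom) ∧
    -- its projection to the first coordinate
    ((T ≠ StrongSub.StrongType.PC ∨
        ¬ ∃ S : L.Substructure (A ⟨0, by omega⟩),
            StrongSub.IsNontrivial S ∧ StrongSub.IsCentral S) →
      StrongSub.IsOfType T
        ((R ⊓ StrongSub.prodSub B).map (StrongSub.projHom L A ⟨0, by omega⟩))) ∧
    (StrongSub.IsEssential (R : Set (∀ i, A i)) (fun i => (B i : Set (A i))) →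
      (T = StrongSub.StrongType.C ∨ T = StrongSub.StrongType.PC) ∧ n = 2) := by
  have hRidem : StrongSub.IsIdempotent L R := (StrongSub.IsIdempotent.pi hidem).substructure R
  let π : ∀ i, FirstOrder.Language.Hom L R (A i) := fun i => StrongSub.restrict (StrongSub.projHom L A i) R
  have hπ : ∀ i, Function.Surjective (π i) := fun i a => by
    obtain ⟨r, hr, hra⟩ := hR i a
    exact ⟨⟨r, hr⟩, hra⟩
  have hinf : (StrongSub.prodSub B).comap R.subtype.toHom = ⨅ i, (B i).comap (π i) := by
    ext q
    rw [FirstOrder.Language.Substructure.mem_iInf]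
    rfl
  have hmap : (R ⊓ StrongSub.prodSub B).map (StrongSub.projHom L A ⟨0, by omega⟩) =
      (⨅ i, (B i).comap (π i)).map (π ⟨0, by omega⟩) := by
    rw [← hinf]
    ext a
    simp only [FirstOrder.Language.Substructure.mem_map]
    constructor
    · rintro ⟨r, ⟨hr, hrB⟩, rfl⟩
      exact ⟨⟨r, hr⟩, hrB, rfl⟩
    · rintro ⟨⟨r, hr⟩, hrB, rfl⟩
      exact ⟨r, ⟨hr, hrB⟩, rfl⟩
  have hcrit : StrongSub.IsEssential (R : Set (∀ i, A i)) (fun i => (B i : Set (A i))) →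
      StrongSub.IsCritical fun i => (B i).comap (π i) := by
    rintro ⟨h1, h2⟩
    refine ⟨fun i => ?_, ?_⟩
    · obtain ⟨r, hr, hrB⟩ := h1 i
      exact ⟨⟨r, hr⟩, hrB⟩
    · rintro ⟨⟨r, hr⟩, hrB⟩
      exact h2 ⟨r, hr, hrB⟩
  rw [hinf, hmap]
  cases T with
  | BA t =>
    have hinfBA : StrongSub.Absorbs (⨅ i, (B i).comap (π i)) t :=
      StrongSub.Absorbs.iInf fun i => StrongSub.Absorbs.comap (π i) (hB i)
    refine ⟨hinfBA, fun _ => StrongSub.Absorbs.map (hπ _) hinfBA, fun hess => ?_⟩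
    -- The arity 2 of `t` is at most `n`, so a critical family is impossible.
    exact absurd (hcrit hess) (StrongSub.not_isCritical_of_absorbs (by simpa using hn) fun i =>
      StrongSub.Absorbs.comap (π i) (hB i))
  | C =>
    have hC : ∀ i, StrongSub.IsCentral ((B i).comap (π i)) := fun i =>
      StrongSub.IsCentral.comap (π i) (hB i)
    refine ⟨StrongSub.IsCentral.iInf hC, fun _ => (StrongSub.IsCentral.iInf hC).map hRidem (hπ _),
      fun hess => ⟨Or.inl rfl, le_antisymm ?_ hn⟩⟩
    simpa using (hcrit hess).card_le_two hRidem hC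
  | PC =>
    have hPC : ∀ i, StrongSub.IsPC ((B i).comap (π i)) := fun i =>
      StrongSub.IsPC.comap hRidem (hπ i) (hB i)
    refine ⟨StrongSub.IsPC.iInf hRidem hPC, fun hAC => ?_,
      fun hess => ⟨Or.inr rfl, le_antisymm ?_ hn⟩⟩
    · refine (StrongSub.IsPC.iInf hRidem hPC).map hRidem (fun S hS hS' => ?_) (hπ _)
      exact (hAC.resolve_left fun h => h rfl) ⟨S, hS, hS'⟩
    · simpa using (hcrit hess).card_le_two_of_isPC hRidem hPC
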